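/- Let $M$ be an orientable smooth 3-dimensional manifold (Hausdorff, second countable) with a Poisson structure $\Lambda$ that is regular of rank $2$, and let $F$ be its symplectic foliation, $TF=\#(T^*M)$, where $\#:T^*M\to TM$ is defined by $\beta(\alpha^\#)=\Lambda(\alpha,\beta)$. Suppose that $F$ is defined by a closed 1-form $\beta$: $d\beta=0$ and $\ker\beta_x=T_xF$ for every $x\in M$. Let $\nu F$ be any smooth distribution with $TM=TF\oplus\nu F$. Notation. Let $\sigma$ be the Poisson differential on the multivector fields $\mathcal V^k(M)$, viewed as alternating $C^\infty(M)$-multilinear maps on 1-forms: $$(\sigma Q)(\alpha_0,\dots,\alpha_k)=\sum_i(-1)^i\alpha_i^\#\big(Q(\dots,\widehat{\alpha_i},\dots)\big)+\sum_{i<j}(-1)^{i+j}Q(\{\alpha_i,\alpha_j\},\dots,\widehat{\alpha_i},\dots,\widehat{\alpha_j},\dots),$$ with $\{\alpha,\beta\}=L_{\alpha^\#}\beta-L_{\beta^\#}\alpha-d(\Lambda(\alpha,\beta))$, and let $H^k_\Lambda(M)$ be its cohomology. Put $\mathcal V_{p,q}(M)=\Gamma(\Lambda^qTF\otimes\Lambda^p\nu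 F)$ and let $\Omega_{p,q}(M)$ be the forms of degree $p+q$ with $p$ transversal and $q$ tangential arguments. Let $\sigma''$ be the part of type $(0,1)$ of $\sigma$ and $d''$ the part of type $(0,1)$ of $d$. The tangential Poisson cohomology is $H^q_{\Lambda,\mathrm{tan}}(M)=H^q(\mathcal V_{0,\bullet}(M),\sigma'')$, and $H^q(M,P^p(F))=H^q(\Omega_{p,\bullet}(M),d'')$. Let $\sigma(\mathcal V_{1,0}(M))\subset H^2_{\Lambda,\mathrm{tan}}(M)$ denote the subspace of the classes of those bivector fields $\sigma(V)$, $V\in\mathcal V_{1,0}(M)$, that lie in $\mathcal V_{0,2}(M)$. Let $I(M)$ be the algebra of Casimir functions of $\Lambda$, that is, of the functions with trivial Hamiltonian vector field. Then: (i) there are an isomorphism of real vector spaces $$H^2_\Lambda(M)\;\cong\;\frac{H^2_{\Lambda,\mathrm{tan}}(M)}{\sigma(\mathcal V_{1,0}(M))}\;\oplus\;H^1(M,P^1(F))$$ and an isomorphism of $I(M)$-modules $$H^3_\Lambda(M)\;\cong\;H^2(M,P^1(F));$$ (ii) $H^q_{\Lambda,\mathrm{tan}}(M)\cong H^q(M,P^1(F))$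 as $I(M)$-modules, for all $q\ge 0$. -/

import Mathlib

open scoped Manifold ContDiff
set_option linter.unusedSectionVars false

noncomputable section

namespace PoissonGeom

/-- A bracket on an `A`-module `L` which is biadditive, skew-symmetric and satisfies the Leibniz rule
`[a, f b] = f [a, b] + (ρ(a) f) b` for a linear anchor `ρ` with values in the derivations of `A`.
It is used for two concrete brackets only, both constructed below: the Lie bracket of vector fields
and the bracket of 1-forms of a Poisson structure. These three properties are what makes the usual
formula for the differential define an operator on alternating `A`-multilinear maps. -/
structure AnchoredBracket (A L : Type*) [CommRing A] [Algebra ℝ A] [AddCommGroup L]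
    [Module A L] where
  anchor : L →ₗ[A] Derivation ℝ A A
  bracket : L → L → L
  bracket_add : ∀ a b c, bracket a (b + c) = bracket a b + bracket a c
  bracket_skew : ∀ a b, bracket a b = -bracket b a
  bracket_smul : ∀ a (f : A) b, bracket a (f • b) = f • bracket a b + anchor a f • b

namespace AnchoredBracket
variable {A L : Type*} [CommRing A] [Algebra ℝ A] [AddCommGroup L] [Module A L]
  (B : AnchoredBracket A L) {k : ℕ}

lemma add_bracket (a b c : L) : B.bracket (a + b) c = B.bracket a c + B.bracket b c := by
  rw [B.bracket_skew, B.bracket_add, neg_add, ← B.bracket_skew, ← B.bracket_skew]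

lemma smul_bracket (f : A) (a b : L) :
    B.bracket (f • a) b = f • B.bracket a b - B.anchor b f • a := by
  rw [B.bracket_skew, B.bracket_smul, B.bracket_skew b a]
  simp [sub_eq_add_neg, add_comm]

/-- The value on `v = (v₀, …, v_k)` of the differential of a `k`-cochain `Q`:
`∑_j (-1)^j ρ(v_j) (Q(…, v̂_j, …)) + ∑_{i<j} (-1)^j Q(…, [v_i, v_j], …, v̂_j, …)`,
where in the second sum `[v_i, v_j]` stands in the slot of `v_i`. Moving the bracket to the first slot
gives the sign `(-1)^(i+j)` of the usual formula
`∑_{i<j} (-1)^(i+j) Q([v_i, v_j], v₀, …, v̂_i, …, v̂_j, …, v_k)`. -/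
def differentialFun (Q : L [⋀^Fin k]→ₗ[A] A) (v : Fin (k + 1) → L) : A :=
  ∑ j : Fin (k + 1), (-1) ^ (j : ℕ) * B.anchor (v j) (Q (j.removeNth v)) +
    ∑ j : Fin (k + 1), ∑ i ∈ Finset.Iio j,
      (-1) ^ (j : ℕ) * Q (j.removeNth (Function.update v i (B.bracket (v i) (v j))))

lemma swap_term (Q : L [⋀^Fin k]→ₗ[A] A) (v : Fin (k + 1) → L) (i j : Fin (k + 1)) (h : i ≠ j)
    (b : L) :
    (-1) ^ (i : ℕ) * Q (i.removeNth (Function.update v j b)) =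
      -((-1) ^ (j : ℕ) * Q (j.removeNth (Function.update v i b))) := by
  have h1 := Q.neg_one_pow_smul_map_removeNth_add_eq_zero_of_eq
    (v := Function.update (Function.update v i b) j b) (i := i) (j := j)
    (by simp [Function.update_of_ne h]) h
  have h2 : i.removeNth (Function.update (Function.update v i b) j b) =
      i.removeNth (Function.update v j b) := by
    rw [Function.update_comm h, Fin.removeNth_update]
  rw [Fin.removeNth_update, h2] at h1
  rw [eq_neg_iff_add_eq_zero, ← h1]
  simp [zsmul_eq_mul]

/-- The term of the second sum of the differential belonging to the pair `(i, j)`. -/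
def pairTerm (Q : L [⋀^Fin k]→ₗ[A] A) (v : Fin (k + 1) → L) (j i : Fin (k + 1)) : A :=
  (-1) ^ (j : ℕ) * Q (j.removeNth (Function.update v i (B.bracket (v i) (v j))))


lemma slot_add (Q : L [⋀^Fin k]→ₗ[A] A) (v : Fin (k + 1) → L) {i j : Fin (k + 1)} (h : i ≠ j)
    (x y : L) :
    Q (j.removeNth (Function.update v i (x + y))) =
      Q (j.removeNth (Function.update v i x)) + Q (j.removeNth (Function.update v i y)) := by
  obtain ⟨m, rfl⟩ := Fin.exists_succAbove_eq h
  simp only [Fin.removeNth_update_succAbove, AlternatingMap.map_update_add]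

lemma slot_smul (Q : L [⋀^Fin k]→ₗ[A] A) (v : Fin (k + 1) → L) {i j : Fin (k + 1)} (h : i ≠ j)
    (f : A) (x : L) :
    Q (j.removeNth (Function.update v i (f • x))) =
      f * Q (j.removeNth (Function.update v i x)) := by
  obtain ⟨m, rfl⟩ := Fin.exists_succAbove_eq h
  simp only [Fin.removeNth_update_succAbove, AlternatingMap.map_update_smul, smul_eq_mul]

lemma slot_eq_zero (Q : L [⋀^Fin k]→ₗ[A] A) (v : Fin (k + 1) → L) {a b j : Fin (k + 1)}
    (hab : a ≠ b) (ha : a ≠ j) (hb : b ≠ j) (h : v a = v b) : Q (j.removeNth v) = 0 := by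
  obtain ⟨m, rfl⟩ := Fin.exists_succAbove_eq ha
  obtain ⟨n, rfl⟩ := Fin.exists_succAbove_eq hb
  exact Q.map_eq_zero_of_eq _ h (fun h => hab (by rw [h]))

lemma pairTerm_comm (Q : L [⋀^Fin k]→ₗ[A] A) (v : Fin (k + 1) → L) (i j : Fin (k + 1))
    (h : i ≠ j) : B.pairTerm Q v j i = B.pairTerm Q v i j := by
  unfold pairTerm
  rw [swap_term Q v j i h.symm, B.bracket_skew (v i) (v j), ← neg_one_smul A (B.bracket _ _),
    slot_smul Q v h.symm]
  ring

lemma two_mul_differentialFun (Q : L [⋀^Fin k]→ₗ[A] A) (v : Fin (k + 1) → L) :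
    2 * B.differentialFun Q v =
      ∑ j : Fin (k + 1), (2 * ((-1) ^ (j : ℕ) * B.anchor (v j) (Q (j.removeNth v))) +
        ∑ i ∈ Finset.univ.erase j, B.pairTerm Q v j i) := by
  have h : ∀ j : Fin (k + 1), ∑ i ∈ Finset.univ.erase j, B.pairTerm Q v j i =
      ∑ i ∈ Finset.Iio j, B.pairTerm Q v j i + ∑ i ∈ Finset.Ioi j, B.pairTerm Q v j i := by
    intro j
    rw [← Finset.sum_union]
    · congr 1; ext i; simp [lt_or_lt_iff_ne]
    · rw [Finset.disjoint_left]; intro i; simp only [Finset.mem_Iio, Finset.mem_Ioi]; omega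
  have h2 : ∑ j : Fin (k + 1), ∑ i ∈ Finset.Ioi j, B.pairTerm Q v j i =
      ∑ j : Fin (k + 1), ∑ i ∈ Finset.Iio j, B.pairTerm Q v j i := by
    rw [Finset.sum_comm' (t' := Finset.univ) (s' := fun i => Finset.Iio i) (by simp)]
    refine Finset.sum_congr rfl fun i _ => Finset.sum_congr rfl fun j hj => ?_
    exact B.pairTerm_comm Q v i j (Finset.mem_Iio.1 hj).ne'
  rw [Finset.sum_add_distrib, ← Finset.mul_sum, Finset.sum_congr rfl fun j _ => h j,
    Finset.sum_add_distrib, h2, differentialFun]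
  simp only [pairTerm]
  ring

lemma eq_of_two_mul {x y : A} (h : 2 * x = 2 * y) : x = y := by
  have h2 : algebraMap ℝ A (1 / 2) * 2 = 1 := by
    rw [← map_ofNat (algebraMap ℝ A) 2, ← map_mul]; norm_num
  calc x = algebraMap ℝ A (1 / 2) * (2 * x) := by rw [← mul_assoc, h2, one_mul]
    _ = algebraMap ℝ A (1 / 2) * (2 * y) := by rw [h]
    _ = y := by rw [← mul_assoc, h2, one_mul]

lemma pairTerm_update_left (Q : L [⋀^Fin k]→ₗ[A] A) (v : Fin (k + 1) → L) {i j : Fin (k + 1)}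
    (h : i ≠ j) (z : L) : B.pairTerm Q (Function.update v j z) j i =
      (-1) ^ (j : ℕ) * Q (j.removeNth (Function.update v i (B.bracket (v i) z))) := by
  simp only [pairTerm, Function.update_self, Function.update_of_ne h]
  rw [Function.update_comm h.symm, Fin.removeNth_update]

lemma pairTerm_update_right (Q : L [⋀^Fin k]→ₗ[A] A) (v : Fin (k + 1) → L) {i j : Fin (k + 1)}
    (h : i ≠ j) (z : L) : B.pairTerm Q (Function.update v i z) j i =
      (-1) ^ (j : ℕ) * Q (j.removeNth (Function.update v i (B.bracket z (v j)))) := by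
  simp only [pairTerm, Function.update_self, Function.update_of_ne h.symm, Function.update_idem]

lemma pairTerm_update_of_ne (Q : L [⋀^Fin k]→ₗ[A] A) (v : Fin (k + 1) → L)
    {a i j : Fin (k + 1)} (hi : a ≠ i) (hj : a ≠ j) (z : L) :
    B.pairTerm Q (Function.update v a z) j i = (-1) ^ (j : ℕ) *
      Q (j.removeNth (Function.update (Function.update v i (B.bracket (v i) (v j))) a z)) := by
  simp only [pairTerm, Function.update_of_ne hi.symm, Function.update_of_ne hj.symm]
  rw [Function.update_comm hi]

lemma differentialFun_update_add (Q : L [⋀^Fin k]→ₗ[A] A) (v : Fin (k + 1) → L)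
    (a : Fin (k + 1)) (x y : L) :
    B.differentialFun Q (Function.update v a (x + y)) =
      B.differentialFun Q (Function.update v a x) + B.differentialFun Q (Function.update v a y) := by
  apply eq_of_two_mul
  rw [mul_add, two_mul_differentialFun, two_mul_differentialFun, two_mul_differentialFun,
    ← Finset.sum_add_distrib]
  refine Finset.sum_congr rfl fun j _ => ?_
  have h1 : B.anchor (Function.update v a (x + y) j)
        (Q (j.removeNth (Function.update v a (x + y)))) =
      B.anchor (Function.update v a x j) (Q (j.removeNth (Function.update v a x))) +
      B.anchor (Function.update v a y j) (Q (j.removeNth (Function.update v a y))) := by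
    rcases eq_or_ne a j with rfl | h
    · simp
    · simp [slot_add Q v h, Function.update_of_ne h.symm]
  have h2 : ∀ i ∈ Finset.univ.erase j, B.pairTerm Q (Function.update v a (x + y)) j i =
      B.pairTerm Q (Function.update v a x) j i + B.pairTerm Q (Function.update v a y) j i := by
    intro i hi
    have hij : i ≠ j := Finset.ne_of_mem_erase hi
    rcases eq_or_ne a j with rfl | hj
    · simp only [pairTerm_update_left _ _ _ hij, bracket_add, slot_add Q v hij, mul_add]
    · rcases eq_or_ne a i with rfl | hi
      · simp only [pairTerm_update_right _ _ _ hij, add_bracket, slot_add Q v hij, mul_add]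
      · simp only [pairTerm_update_of_ne _ _ _ hi hj, slot_add Q _ hj, mul_add]
  rw [h1, Finset.sum_congr rfl h2, Finset.sum_add_distrib]
  ring

lemma differentialFun_update_smul (Q : L [⋀^Fin k]→ₗ[A] A) (v : Fin (k + 1) → L)
    (a : Fin (k + 1)) (f : A) (x : L) :
    B.differentialFun Q (Function.update v a (f • x)) =
      f * B.differentialFun Q (Function.update v a x) := by
  apply eq_of_two_mul
  rw [mul_left_comm, two_mul_differentialFun, two_mul_differentialFun,
    ← Finset.add_sum_erase _ _ (Finset.mem_univ a), ← Finset.add_sum_erase _ _ (Finset.mem_univ a)]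
  -- the Leibniz defect of the slot `a`
  have ha : ∑ i ∈ Finset.univ.erase a, B.pairTerm Q (Function.update v a (f • x)) a i =
      f * ∑ i ∈ Finset.univ.erase a, B.pairTerm Q (Function.update v a x) a i +
      ∑ i ∈ Finset.univ.erase a, B.anchor (v i) f *
        ((-1) ^ (a : ℕ) * Q (a.removeNth (Function.update v i x))) := by
    rw [Finset.mul_sum, ← Finset.sum_add_distrib]
    refine Finset.sum_congr rfl fun i hi => ?_
    have hia : i ≠ a := Finset.ne_of_mem_erase hi
    rw [pairTerm_update_left _ _ _ hia, pairTerm_update_left _ _ _ hia, bracket_smul,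
      slot_add Q v hia, slot_smul Q v hia, slot_smul Q v hia]
    ring
  have hj : ∀ j ∈ Finset.univ.erase a,
      2 * ((-1) ^ (j : ℕ) * B.anchor (Function.update v a (f • x) j)
        (Q (j.removeNth (Function.update v a (f • x))))) +
        ∑ i ∈ Finset.univ.erase j, B.pairTerm Q (Function.update v a (f • x)) j i =
      f * (2 * ((-1) ^ (j : ℕ) * B.anchor (Function.update v a x j)
        (Q (j.removeNth (Function.update v a x)))) +
        ∑ i ∈ Finset.univ.erase j, B.pairTerm Q (Function.update v a x) j i) -
      B.anchor (v j) f * ((-1) ^ (a : ℕ) * Q (a.removeNth (Function.update v j x))) := by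
    intro j hj
    have hja : j ≠ a := Finset.ne_of_mem_erase hj
    have hmem : a ∈ Finset.univ.erase j := Finset.mem_erase.2 ⟨hja.symm, Finset.mem_univ _⟩
    rw [swap_term Q v a j hja.symm x]
    rw [← Finset.add_sum_erase _ _ hmem, ← Finset.add_sum_erase _ _ hmem]
    have h3 : ∑ i ∈ (Finset.univ.erase j).erase a,
          B.pairTerm Q (Function.update v a (f • x)) j i =
        f * ∑ i ∈ (Finset.univ.erase j).erase a, B.pairTerm Q (Function.update v a x) j i := by
      rw [Finset.mul_sum]
      refine Finset.sum_congr rfl fun i hi => ?_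
      have hia : a ≠ i := (Finset.ne_of_mem_erase hi).symm
      rw [pairTerm_update_of_ne _ _ _ hia hja.symm, pairTerm_update_of_ne _ _ _ hia hja.symm,
        slot_smul Q _ hja.symm]
      ring
    rw [h3, pairTerm_update_right _ _ _ hja.symm, pairTerm_update_right _ _ _ hja.symm,
      smul_bracket, sub_eq_add_neg, ← neg_smul, slot_add Q v hja.symm, slot_smul Q v hja.symm,
      slot_smul Q v hja.symm, slot_smul Q v hja.symm, Function.update_of_ne hja,
      Function.update_of_ne hja, Derivation.leibniz]
    simp only [smul_eq_mul]
    ring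
  rw [ha, Finset.sum_congr rfl hj, Finset.sum_sub_distrib, ← Finset.mul_sum]
  simp only [Function.update_self, map_smul, Fin.removeNth_update, Derivation.smul_apply,
    smul_eq_mul]
  ring

lemma differentialFun_eq_zero (Q : L [⋀^Fin k]→ₗ[A] A) (v : Fin (k + 1) → L)
    {a b : Fin (k + 1)} (h : v a = v b) (hab : a ≠ b) : B.differentialFun Q v = 0 := by
  apply eq_of_two_mul
  rw [mul_zero, two_mul_differentialFun]
  have hb : b ∈ Finset.univ.erase a := Finset.mem_erase.2 ⟨hab.symm, Finset.mem_univ _⟩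
  have ha : a ∈ Finset.univ.erase b := Finset.mem_erase.2 ⟨hab, Finset.mem_univ _⟩
  have key : ∀ w : Fin (k + 1) → L, w a = w b →
      (-1) ^ (a : ℕ) * Q (a.removeNth w) = -((-1) ^ (b : ℕ) * Q (b.removeNth w)) := by
    intro w hw
    have := swap_term Q w a b hab (w b)
    rw [Function.update_eq_self] at this
    rw [this, ← hw, Function.update_eq_self]
  rw [← Finset.add_sum_erase _ _ (Finset.mem_univ a),
    ← Finset.add_sum_erase _ (fun j : Fin (k + 1) => 2 * ((-1) ^ (j : ℕ) * B.anchor (v j) (Q (j.removeNth v))) +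
        ∑ i ∈ Finset.univ.erase j, B.pairTerm Q v j i) hb,
    Finset.sum_eq_zero (s := (Finset.univ.erase a).erase b), add_zero,
    ← Finset.add_sum_erase _ _ hb, ← Finset.add_sum_erase _ _ ha]
  · have h1 : ∑ i ∈ (Finset.univ.erase a).erase b, B.pairTerm Q v a i =
        -∑ i ∈ (Finset.univ.erase b).erase a, B.pairTerm Q v b i := by
      rw [Finset.erase_right_comm, ← Finset.sum_neg_distrib]
      refine Finset.sum_congr rfl fun i hi => ?_
      have hia : i ≠ a := Finset.ne_of_mem_erase hi
      have hib : i ≠ b := Finset.ne_of_mem_erase (Finset.mem_of_mem_erase hi)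
      unfold pairTerm
      rw [key _ (by rw [Function.update_of_ne hia.symm, Function.update_of_ne hib.symm, h]), h]
    have h2 : (-1) ^ (a : ℕ) * B.anchor (v a) (Q (a.removeNth v)) =
        -((-1) ^ (b : ℕ) * B.anchor (v b) (Q (b.removeNth v))) := by
      have := congrArg (B.anchor (v b)) (key v h)
      rw [map_neg, Derivation.leibniz, Derivation.leibniz] at this
      simpa [Derivation.leibniz_pow, h] using this
    have h3 : B.pairTerm Q v a b = -B.pairTerm Q v b a := by
      unfold pairTerm
      rw [swap_term Q v a b hab, h]
    rw [h1, h2, h3]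
    ring
  · intro j hj
    have hjb : b ≠ j := (Finset.ne_of_mem_erase hj).symm
    have hja : a ≠ j := (Finset.ne_of_mem_erase (Finset.mem_of_mem_erase hj)).symm
    have ma : a ∈ Finset.univ.erase j := Finset.mem_erase.2 ⟨hja, Finset.mem_univ _⟩
    have mb : b ∈ (Finset.univ.erase j).erase a :=
      Finset.mem_erase.2 ⟨hab.symm, Finset.mem_erase.2 ⟨hjb, Finset.mem_univ _⟩⟩
    rw [slot_eq_zero Q v hab hja hjb h, map_zero, mul_zero, mul_zero, zero_add,
      ← Finset.add_sum_erase _ _ ma, ← Finset.add_sum_erase _ _ mb, Finset.sum_eq_zero, add_zero]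
    · -- exchanging the two equal entries changes the sign
      obtain ⟨m, rfl⟩ := Fin.exists_succAbove_eq hja
      obtain ⟨n, rfl⟩ := Fin.exists_succAbove_eq hjb
      have hmn : m ≠ n := fun h => hab (by rw [h])
      unfold pairTerm
      rw [Fin.removeNth_update_succAbove, Fin.removeNth_update_succAbove, ← mul_add]
      have e : j.removeNth v m = j.removeNth v n := h
      have := Q.map_swap (Function.update (j.removeNth v) m
        (B.bracket (v (j.succAbove m)) (v j))) hmn
      have e2 : Function.update (j.removeNth v) m (B.bracket (v (j.succAbove m)) (v j)) ∘
          Equiv.swap m n = Function.update (j.removeNth v) n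
            (B.bracket (v (j.succAbove n)) (v j)) := by
        funext i
        rcases eq_or_ne i m with rfl | him
        · simp [Function.update_of_ne hmn.symm, Function.update_of_ne hmn, e]
        · rcases eq_or_ne i n with rfl | hin
          · simp [h]
          · simp [Equiv.swap_apply_of_ne_of_ne him hin, him, hin]
      rw [e2] at this
      rw [this, add_neg_cancel, mul_zero]
    · intro i hi
      have hib : i ≠ b := Finset.ne_of_mem_erase hi
      have hia : i ≠ a := Finset.ne_of_mem_erase (Finset.mem_of_mem_erase hi)
      unfold pairTerm
      rw [slot_eq_zero Q _ hab hja hjb, mul_zero]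
      rw [Function.update_of_ne hia.symm, Function.update_of_ne hib.symm, h]

/-- The differential as an additive operator from `k`-cochains to `(k + 1)`-cochains. -/
def differential (k : ℕ) : (L [⋀^Fin k]→ₗ[A] A) →+ (L [⋀^Fin (k + 1)]→ₗ[A] A) where
  toFun Q :=
    { toFun := B.differentialFun Q
      map_update_add' := by
        intro inst v a x y
        cases Subsingleton.elim inst (instDecidableEqFin _)
        exact B.differentialFun_update_add Q v a x y
      map_update_smul' := by
        intro inst v a f x
        cases Subsingleton.elim inst (instDecidableEqFin _)
        exact B.differentialFun_update_smul Q v a f x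
      map_eq_zero_of_eq' := fun v _ _ h hab => B.differentialFun_eq_zero Q v h hab }
  map_zero' := by
    ext v; simp [differentialFun]
  map_add' Q R := by
    ext v
    simp [differentialFun, mul_add, Finset.sum_add_distrib]
    ring

@[simp] lemma differential_apply (Q : L [⋀^Fin k]→ₗ[A] A) (v : Fin (k + 1) → L) :
    B.differential k Q v = B.differentialFun Q v := rfl

lemma differentialFun_smul (f : A) (Q : L [⋀^Fin k]→ₗ[A] A) (v : Fin (k + 1) → L) :
    B.differentialFun (f • Q) v = f * B.differentialFun Q v +
      ∑ j : Fin (k + 1), (-1) ^ (j : ℕ) * (B.anchor (v j) f * Q (j.removeNth v)) := by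
  simp only [differentialFun, AlternatingMap.smul_apply, smul_eq_mul, Derivation.leibniz, mul_add,
    Finset.mul_sum, Finset.sum_add_distrib]
  have h1 : ∀ j : Fin (k + 1), (-1) ^ (j : ℕ) * (Q (j.removeNth v) * B.anchor (v j) f) =
    (-1) ^ (j : ℕ) * (B.anchor (v j) f * Q (j.removeNth v)) := fun j => by ring
  simp only [mul_left_comm f, h1]
  ring
end AnchoredBracket


section Cohomology

variable {R : Type*} [CommRing R] {C : ℕ → Type*} [∀ k, AddCommGroup (C k)] [∀ k, Module R (C k)]

/-- The coboundaries of degree `k`; there are none but `0` in degree `0`. -/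
def coboundaries (d : ∀ k, C k →ₗ[R] C (k + 1)) : ∀ k, Submodule R (C k)
  | 0 => ⊥
  | k + 1 => LinearMap.range (d k)

/-- The cohomology `Ker d_k / Im d_{k-1}` of a sequence of linear maps, in degree `k`. -/
def Cohomology (d : ∀ k, C k →ₗ[R] C (k + 1)) (k : ℕ) : Type _ :=
  LinearMap.ker (d k) ⧸ (coboundaries d k).submoduleOf (LinearMap.ker (d k))

namespace Cohomology
variable (d : ∀ k, C k →ₗ[R] C (k + 1)) (k : ℕ)

instance : AddCommGroup (Cohomology d k) :=
  inferInstanceAs (AddCommGroup (LinearMap.ker (d k) ⧸ _))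

instance : Module R (Cohomology d k) :=
  inferInstanceAs (Module R (LinearMap.ker (d k) ⧸ _))

/-- The class of a cocycle. -/
def mk : LinearMap.ker (d k) →ₗ[R] Cohomology d k :=
  Submodule.mkQ ((coboundaries d k).submoduleOf (LinearMap.ker (d k)))

/-- The cohomology classes that have a representative cocycle in `W`. -/
def classesIn (W : Submodule R (C k)) : Submodule R (Cohomology d k) :=
  (W.submoduleOf (LinearMap.ker (d k))).map (mk d k)

instance [Algebra ℝ R] : Module ℝ (Cohomology d k) := Module.compHom _ (algebraMap ℝ R)

instance [Algebra ℝ R] : IsScalarTower ℝ R (Cohomology d k) :=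
  IsScalarTower.of_algebraMap_smul fun _ _ => rfl

end Cohomology

end Cohomology


section Bigrading
variable {A L : Type*} [CommRing A] [AddCommGroup L] [Module A L] {T N : Submodule A L}

/-- The alternating `k`-linear maps of type `(p, k - p)` for the decomposition `L = T ⊕ N`: those which
vanish on all families of homogeneous arguments (each in `T` or in `N`) in which the number of
arguments taken from `N` is not `p`. -/
def ofType (T N : Submodule A L) (p k : ℕ) : Submodule A (L [⋀^Fin k]→ₗ[A] A) where
  carrier := {θ | ∀ (v : Fin k → L) (S : Finset (Fin k)),
    (∀ i ∈ S, v i ∈ N) → (∀ i ∉ S, v i ∈ T) → S.card ≠ p → θ v = 0}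
  add_mem' := fun h₁ h₂ v S hN hT hS => by
    rw [AlternatingMap.add_apply, h₁ v S hN hT hS, h₂ v S hN hT hS, add_zero]
  zero_mem' := fun _ _ _ _ _ => rfl
  smul_mem' := fun f θ h v S hN hT hS => by
    rw [AlternatingMap.smul_apply, h v S hN hT hS, smul_zero]

/-- The arguments `v i`, projected to `N` along `T` for `i ∈ S` and to `T` along `N` for `i ∉ S`. -/
def splitArgs (h : IsCompl T N) {k : ℕ} (S : Finset (Fin k)) (v : Fin k → L) : Fin k → L :=
  fun i => if i ∈ S then N.projection T h.symm (v i) else T.projection N h (v i)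

lemma splitArgs_update (h : IsCompl T N) {k : ℕ} (S : Finset (Fin k)) (v : Fin k → L)
    (a : Fin k) (x : L) : splitArgs h S (Function.update v a x) =
      Function.update (splitArgs h S v) a
        (if a ∈ S then N.projection T h.symm x else T.projection N h x) := by
  funext i
  rcases eq_or_ne i a with rfl | hi
  · simp [splitArgs]
  · simp [splitArgs, hi]

lemma sum_splitArgs_eq_zero (h : IsCompl T N) (p : ℕ) {k : ℕ} (θ : L [⋀^Fin k]→ₗ[A] A)
    (v : Fin k → L) {a b : Fin k} (hv : v a = v b) (hab : a ≠ b) :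
    ∑ S ∈ Finset.powersetCard p Finset.univ, θ (splitArgs h S v) = 0 := by
  have hpre : ∀ (S : Finset (Fin k)) (i : Fin k),
      i ∈ S.map (Equiv.swap a b).toEmbedding ↔ Equiv.swap a b i ∈ S := by
    intro S i; rw [Finset.mem_map_equiv, Equiv.symm_swap]
  have hsw : ∀ S : Finset (Fin k), splitArgs h (S.map (Equiv.swap a b).toEmbedding) v =
      splitArgs h S v ∘ Equiv.swap a b := by
    intro S
    funext i
    have : v (Equiv.swap a b i) = v i := by
      rcases eq_or_ne i a with rfl | hia
      · simp [hv]
      · rcases eq_or_ne i b with rfl | hib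
        · simp [hv]
        · rw [Equiv.swap_apply_of_ne_of_ne hia hib]
    simp only [splitArgs, Function.comp, hpre, this]
  refine Finset.sum_involution (fun S _ => S.map (Equiv.swap a b).toEmbedding) ?_ ?_ ?_ ?_
  · intro S _
    rw [hsw, θ.map_swap _ hab, add_neg_cancel]
  · intro S _ hne hS
    apply hne
    refine θ.map_eq_zero_of_eq _ ?_ hab
    have : (a ∈ S) ↔ (b ∈ S) := by
      conv_lhs => rw [← hS, hpre, Equiv.swap_apply_left]
    simp only [splitArgs, this, hv]
  · intro S hS
    simpa using hS
  · intro S _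
    ext i
    simp

/-- The component of type `(p, k - p)` of an alternating map for the decomposition `L = T ⊕ N`:
`v ↦ ∑_S θ(v_S)`, where `S` runs over the `p`-element sets of slots and `v_S` has the entries with
index in `S` projected to `N` and the others projected to `T`. -/
def component (h : IsCompl T N) (p k : ℕ) :
    (L [⋀^Fin k]→ₗ[A] A) →ₗ[A] (L [⋀^Fin k]→ₗ[A] A) where
  toFun θ :=
    { toFun := fun v => ∑ S ∈ Finset.powersetCard p Finset.univ, θ (splitArgs h S v)
      map_update_add' := by
        intro inst v a x y
        cases Subsingleton.elim inst (instDecidableEqFin _)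
        rw [← Finset.sum_add_distrib]
        refine Finset.sum_congr rfl fun S _ => ?_
        simp only [splitArgs_update]
        split_ifs <;> rw [map_add, AlternatingMap.map_update_add]
      map_update_smul' := by
        intro inst v a f x
        cases Subsingleton.elim inst (instDecidableEqFin _)
        rw [Finset.smul_sum]
        refine Finset.sum_congr rfl fun S _ => ?_
        simp only [splitArgs_update]
        split_ifs <;> rw [map_smul, AlternatingMap.map_update_smul]
      map_eq_zero_of_eq' := fun v _ _ hv hab => sum_splitArgs_eq_zero h p θ v hv hab }
  map_add' θ η := by ext v; simp [Finset.sum_add_distrib]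
  map_smul' f θ := by ext v; simp [Finset.mul_sum]

lemma component_apply (h : IsCompl T N) (p k : ℕ) (θ : L [⋀^Fin k]→ₗ[A] A) (v : Fin k → L) :
    component h p k θ v = ∑ S ∈ Finset.powersetCard p Finset.univ, θ (splitArgs h S v) := rfl

lemma splitArgs_mem_right (h : IsCompl T N) {k : ℕ} {S : Finset (Fin k)} (v : Fin k → L)
    {i : Fin k} (hi : i ∈ S) : splitArgs h S v i ∈ N := by
  rw [splitArgs, if_pos hi]; exact Submodule.projection_apply_mem _ _

lemma splitArgs_mem_left (h : IsCompl T N) {k : ℕ} {S : Finset (Fin k)} (v : Fin k → L)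
    {i : Fin k} (hi : i ∉ S) : splitArgs h S v i ∈ T := by
  rw [splitArgs, if_neg hi]; exact Submodule.projection_apply_mem _ _

lemma component_mem (h : IsCompl T N) (p k : ℕ) (θ : L [⋀^Fin k]→ₗ[A] A) :
    component h p k θ ∈ ofType T N p k := by
  intro v S hN hT hS
  rw [component_apply]
  refine Finset.sum_eq_zero fun R hR => ?_
  have hRS : ¬ (R = S) := by
    rintro rfl; exact hS (Finset.mem_powersetCard.1 hR).2
  obtain ⟨i, hi⟩ : ∃ i, ¬ (i ∈ R ↔ i ∈ S) := by
    by_contra hc; push Not at hc; exact hRS (Finset.ext hc)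
  refine θ.map_coord_zero i ?_
  by_cases hiR : i ∈ R
  · have hiS : i ∉ S := fun hiS => hi ⟨fun _ => hiS, fun _ => hiR⟩
    rw [splitArgs, if_pos hiR, Submodule.projection_apply_eq_zero_iff]
    exact hT i hiS
  · have hiS : i ∈ S := by_contra fun hiS => hi ⟨fun x => (hiR x).elim, fun x => (hiS x).elim⟩
    rw [splitArgs, if_neg hiR, Submodule.projection_apply_eq_zero_iff]
    exact hN i hiS

variable [Algebra ℝ A]

lemma component_differential_smul (B : AnchoredBracket A L) (h : IsCompl T N) {p k : ℕ} {f : A}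
    (hf : ∀ a ∈ T, B.anchor a f = 0) {θ : L [⋀^Fin k]→ₗ[A] A} (hθ : θ ∈ ofType T N p k) :
    component h p (k + 1) (B.differential k (f • θ)) =
      f • component h p (k + 1) (B.differential k θ) := by
  ext v
  rw [AlternatingMap.smul_apply, component_apply, component_apply, Finset.smul_sum]
  refine Finset.sum_congr rfl fun S hS => ?_
  rw [AnchoredBracket.differential_apply, AnchoredBracket.differential_apply,
    AnchoredBracket.differentialFun_smul, smul_eq_mul, add_eq_left]
  refine Finset.sum_eq_zero fun j _ => ?_
  by_cases hj : j ∈ S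
  · have hcard : (Finset.univ.filter fun i => j.succAbove i ∈ S).card ≠ p := by
      have h1 : (Finset.univ.filter fun i => j.succAbove i ∈ S).map (Fin.succAboveEmb j)
          = S.erase j := by
        ext i
        simp only [Finset.mem_map, Finset.mem_filter, Finset.mem_univ, true_and,
          Finset.mem_erase]
        constructor
        · rintro ⟨m, hm, rfl⟩
          exact ⟨Fin.succAbove_ne j m, hm⟩
        · rintro ⟨hij, hi⟩
          obtain ⟨m, rfl⟩ := Fin.exists_succAbove_eq hij
          exact ⟨m, hi, rfl⟩
      have h2 := congrArg Finset.card h1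
      rw [Finset.card_map, Finset.card_erase_of_mem hj] at h2
      have h3 := (Finset.mem_powersetCard.1 hS).2
      have h4 := Finset.card_pos.2 ⟨j, hj⟩
      omega
    rw [hθ _ (Finset.univ.filter fun i => j.succAbove i ∈ S) ?_ ?_ hcard, mul_zero, mul_zero]
    · intro i hi
      exact splitArgs_mem_right h v (Finset.mem_filter.1 hi).2
    · intro i hi
      exact splitArgs_mem_left h v fun hc => hi (Finset.mem_filter.2 ⟨Finset.mem_univ _, hc⟩)
  · rw [hf _ (splitArgs_mem_left h v hj), zero_mul, mul_zero]

instance (p k : ℕ) : AddCommGroup (ofType T N p k) := Submodule.addCommGroup _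

instance (R : Subalgebra ℝ A) (p k : ℕ) : Module R (ofType T N p k) := Submodule.module' _

/-- The leafwise part of the differential: on cochains of type `(p, k - p)`, the component of type
`(p, k + 1 - p)` of the differential. It is linear over functions which are constant along `T`. -/
def leafDifferential (B : AnchoredBracket A L) (h : IsCompl T N) (R : Subalgebra ℝ A)
    (hR : ∀ f ∈ R, ∀ a ∈ T, B.anchor a f = 0) (p k : ℕ) :
    ofType T N p k →ₗ[R] ofType T N p (k + 1) where
  toFun θ := ⟨component h p (k + 1) (B.differential k θ), component_mem h p (k + 1) _⟩
  map_add' θ η := by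
    ext1; simp only [Submodule.coe_add, map_add]
  map_smul' f θ := by
    ext1; exact component_differential_smul B h (hR f f.2) θ.2

/-- The differential on all cochains; it is linear over the functions annihilated by all anchors. -/
def totalDifferential (B : AnchoredBracket A L) (R : Subalgebra ℝ A)
    (hR : ∀ f ∈ R, ∀ a, B.anchor a f = 0) (k : ℕ) :
    (L [⋀^Fin k]→ₗ[A] A) →ₗ[R] (L [⋀^Fin (k + 1)]→ₗ[A] A) where
  toFun := B.differential k
  map_add' := map_add _
  map_smul' f Q := by
    ext1 v
    change B.differentialFun ((f : A) • Q) v = (f : A) * B.differentialFun Q v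
    rw [AnchoredBracket.differentialFun_smul, add_eq_left]
    refine Finset.sum_eq_zero fun j _ => ?_
    rw [hR f f.2, zero_mul, mul_zero]

section
variable (B : AnchoredBracket A L) (h : IsCompl T N) (R : Subalgebra ℝ A)
  (hR : ∀ f ∈ R, ∀ a ∈ T, B.anchor a f = 0) (hR' : ∀ f ∈ R, ∀ a, B.anchor a f = 0)

/-- Cohomology of all cochains with the differential. -/
abbrev TotalCohomology (k : ℕ) : Type _ :=
  Cohomology (C := fun j => L [⋀^Fin j]→ₗ[A] A) (totalDifferential B R hR') k

/-- Cohomology of the cochains of type `(p, •)` with the leafwise part of the differential, in total degree `k`. -/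
abbrev LeafCohomology (p k : ℕ) : Type _ :=
  Cohomology (C := fun j => ofType T N p j) (leafDifferential B h R hR p) k

/-- The cochains of type `(0, k + 1)` that are differentials (full differentials, not only a component
of them) of cochains of type `(1, k - 1)`. -/
def transverseImage (hR' : ∀ f ∈ R, ∀ a, B.anchor a f = 0) (k : ℕ) :
    Submodule R (ofType T N 0 (k + 1)) where
  carrier := {Q | ∃ V ∈ ofType T N 1 k, B.differential k V = Q}
  zero_mem' := ⟨0, Submodule.zero_mem _, map_zero _⟩
  add_mem' := by
    rintro Q S ⟨V, hV, hQ⟩ ⟨W, hW, hS⟩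
    exact ⟨V + W, Submodule.add_mem _ hV hW, (map_add _ V W).trans (congrArg₂ (· + ·) hQ hS)⟩
  smul_mem' := by
    rintro f Q ⟨V, hV, hQ⟩
    exact ⟨(f : A) • V, Submodule.smul_mem _ _ hV,
      ((totalDifferential B R hR' k).map_smul f V).trans (congrArg ((f : A) • ·) hQ)⟩

/-- The leafwise cohomology classes represented by differentials of cochains of type `(1, k - 1)`. -/
def transverseClasses (hR' : ∀ f ∈ R, ∀ a, B.anchor a f = 0) (k : ℕ) :
    Submodule R (LeafCohomology B h R hR 0 (k + 1)) :=
  Cohomology.classesIn (C := fun j => ofType T N 0 j) (leafDifferential B h R hR 0) (k + 1)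
    (transverseImage B R hR' k)

end

end Bigrading


section Geometry
variable (E : Type*) [NormedAddCommGroup E] [NormedSpace ℝ E] [FiniteDimensional ℝ E]
  (M : Type*) [TopologicalSpace M] [ChartedSpace E M] [IsManifold 𝓘(ℝ, E) ∞ M]

/-- The algebra `C^∞(M)` of smooth real functions. -/
abbrev SmoothFunction : Type _ := C^∞⟮𝓘(ℝ, E), M; ℝ⟯

/-- Smooth vector fields, that is smooth sections of the tangent bundle. -/
abbrev SmoothVectorField : Type _ :=
  Cₛ^∞⟮𝓘(ℝ, E); E, (TangentSpace 𝓘(ℝ, E) : M → Type _)⟯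

variable {E M}

instance : SMul (SmoothFunction E M) (SmoothVectorField E M) :=
  ⟨fun f X => ⟨(f : M → ℝ) • (X : ∀ x, TangentSpace 𝓘(ℝ, E) x),
    f.contMDiff.smul_section X.contMDiff⟩⟩

lemma smul_vectorField_apply (f : SmoothFunction E M) (X : SmoothVectorField E M) (x : M) :
    (f • X) x = f x • X x := rfl

instance : Module (SmoothFunction E M) (SmoothVectorField E M) where
  one_smul X := by ext x; exact one_smul _ _
  mul_smul f g X := by ext x; exact mul_smul _ _ _
  smul_zero f := by ext x; exact smul_zero _
  smul_add f X Y := by ext x; exact smul_add _ _ _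
  add_smul f g X := by ext x; exact add_smul _ _ _
  zero_smul X := by ext x; exact zero_smul _ _

lemma mdiffAt_function (f : SmoothFunction E M) (x : M) :
    MDifferentiableAt 𝓘(ℝ, E) 𝓘(ℝ, ℝ) f x :=
  f.contMDiff.mdifferentiable (by simp) x

lemma mdiffAt_vectorField (X : SmoothVectorField E M) (x : M) :
    MDifferentiableAt 𝓘(ℝ, E) (𝓘(ℝ, E).prod 𝓘(ℝ, E))
      (fun y => (Bundle.TotalSpace.mk' E y (X y) : TangentBundle 𝓘(ℝ, E) M)) x :=
  X.contMDiff.mdifferentiable (by simp) x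

/-- The derivative `X(f)` of a function along a vector field. -/
def lieDerivFunction (X : SmoothVectorField E M) (f : SmoothFunction E M) :
    SmoothFunction E M :=
  ⟨fun x => mvfderiv 𝓘(ℝ, E) f x (X x), by
    have h1 : ContMDiff 𝓘(ℝ, E) (𝓘(ℝ, ℝ).prod 𝓘(ℝ, ℝ)) ∞
        (fun x => tangentMap 𝓘(ℝ, E) 𝓘(ℝ, ℝ) f (Bundle.TotalSpace.mk' E x (X x))) :=
      (f.contMDiff.contMDiff_tangentMap (m := ∞) (by simp)).comp X.contMDiff
    exact (contMDiff_snd_tangentBundle_modelSpace ℝ 𝓘(ℝ, ℝ)).comp h1⟩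

lemma lieDerivFunction_apply (X : SmoothVectorField E M) (f : SmoothFunction E M) (x : M) :
    lieDerivFunction X f x = mvfderiv 𝓘(ℝ, E) f x (X x) := rfl

/-- The Lie bracket of vector fields. -/
def lieBracket (X Y : SmoothVectorField E M) : SmoothVectorField E M :=
  ⟨VectorField.mlieBracket 𝓘(ℝ, E) X Y, by
    have : IsManifold 𝓘(ℝ, E) ((⊤ : ℕ∞) + 1) M := by simpa using ‹IsManifold 𝓘(ℝ, E) ∞ M›
    have : IsManifold 𝓘(ℝ, E) (minSmoothness ℝ 2) M := by
      rw [minSmoothness_of_isRCLikeNormedField]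
      exact IsManifold.of_le (n := ∞) (by norm_cast)
    exact ContDiff.mlieBracket_vectorField (n := ⊤) (m := ⊤) X.contMDiff Y.contMDiff (by simp)⟩

lemma lieBracket_apply (X Y : SmoothVectorField E M) (x : M) :
    lieBracket X Y x = VectorField.mlieBracket 𝓘(ℝ, E) X Y x := rfl

/-- A vector field as a derivation of `C^∞(M)`. -/
def toDerivation (X : SmoothVectorField E M) :
    Derivation ℝ (SmoothFunction E M) (SmoothFunction E M) :=
  Derivation.mk'
    { toFun := lieDerivFunction X
      map_add' := fun f g => by
        ext x
        have := mvfderiv_add (mdiffAt_function f x) (mdiffAt_function g x)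
        exact congrArg (fun φ => φ (X x)) this
      map_smul' := fun c f => by
        ext x
        have := mvfderiv_smul (mdifferentiableAt_const (c := c)) (mdiffAt_function f x)
        rw [mvfderiv_const] at this
        refine (congrArg (fun φ => φ (X x)) this).trans ?_
        simp
        exact Or.inl rfl }
    (fun f g => by
        ext x
        have := mvfderiv_mul (mdiffAt_function f x) (mdiffAt_function g x)
        exact congrArg (fun φ => φ (X x)) this)

variable (E M) in
/-- Vector fields with the Lie bracket, acting on functions by derivation. -/
def tangentAlgebroid : AnchoredBracket (SmoothFunction E M) (SmoothVectorField E M) where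
  anchor :=
    { toFun := toDerivation
      map_add' := fun X Y => by
        ext f x; exact map_add (mvfderiv 𝓘(ℝ, E) f x) (X x) (Y x)
      map_smul' := fun f X => by
        ext g x; exact map_smul (mvfderiv 𝓘(ℝ, E) g x) (f x) (X x) }
  bracket := lieBracket
  bracket_add X Y Z := by
    ext x; exact VectorField.mlieBracket_add_right (mdiffAt_vectorField Y x) (mdiffAt_vectorField Z x)
  bracket_skew X Y := by
    ext x; exact VectorField.mlieBracket_swap_apply
  bracket_smul X f Y := by
    ext x
    have := VectorField.mlieBracket_smul_right (V := X) (mdiffAt_function f x) (mdiffAt_vectorField Y x)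
    exact this.trans (add_comm _ _)


lemma anchor_apply (X : SmoothVectorField E M) (f : SmoothFunction E M) :
    (tangentAlgebroid E M).anchor X f = lieDerivFunction X f := rfl

variable (E M) in
/-- Differential forms of degree `k`: alternating `C^∞(M)`-multilinear maps on vector fields. -/
abbrev DifferentialForm (k : ℕ) : Type _ :=
  SmoothVectorField E M [⋀^Fin k]→ₗ[SmoothFunction E M] SmoothFunction E M

variable (E M) in
/-- Differential 1-forms: `C^∞(M)`-linear maps from vector fields to functions. -/
abbrev OneForm : Type _ := Module.Dual (SmoothFunction E M) (SmoothVectorField E M)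

variable (E M) in
/-- Multivector fields of degree `k`: alternating `C^∞(M)`-multilinear maps on 1-forms. -/
abbrev MultivectorField (k : ℕ) : Type _ :=
  OneForm E M [⋀^Fin k]→ₗ[SmoothFunction E M] SmoothFunction E M

variable (E M) in
/-- The exterior derivative of differential forms. -/
def exteriorDerivative (k : ℕ) : DifferentialForm E M k →+ DifferentialForm E M (k + 1) :=
  (tangentAlgebroid E M).differential k

variable (E M) in
/-- Orientability: there is a nowhere vanishing form of top degree. -/
def IsOrientable : Prop :=
  ∃ μ : DifferentialForm E M (Module.finrank ℝ E), ∀ x : M, ∃ X, μ X x ≠ 0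

/-- The differential `df` of a function. -/
def differentialFunction (f : SmoothFunction E M) : OneForm E M where
  toFun X := lieDerivFunction X f
  map_add' X Y := by
    rw [← anchor_apply, map_add]; rfl
  map_smul' g X := by
    rw [← anchor_apply, map_smul]; rfl

lemma differentialFunction_apply (f : SmoothFunction E M) (X : SmoothVectorField E M) :
    differentialFunction f X = lieDerivFunction X f := rfl

lemma differentialFunction_add (f g : SmoothFunction E M) :
    differentialFunction (f + g) = differentialFunction f + differentialFunction g := by
  ext1 X; exact map_add (toDerivation X) f g

lemma differentialFunction_neg (f : SmoothFunction E M) :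
    differentialFunction (-f) = -differentialFunction f := by
  ext1 X; exact map_neg (toDerivation X) f

lemma differentialFunction_mul (f g : SmoothFunction E M) :
    differentialFunction (f * g) = f • differentialFunction g + g • differentialFunction f := by
  ext1 X; exact (toDerivation X).leibniz f g

lemma differentialFunction_algebraMap (c : ℝ) :
    differentialFunction (algebraMap ℝ (SmoothFunction E M) c) = 0 := by
  ext1 X; exact (toDerivation X).map_algebraMap c

/-- The Lie derivative of a 1-form: `(L_X α)(Y) = X(α(Y)) - α([X, Y])`. -/
def lieDerivOneForm (X : SmoothVectorField E M) (α : OneForm E M) : OneForm E M where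
  toFun Y := lieDerivFunction X (α Y) - α (lieBracket X Y)
  map_add' Y Z := by
    have h : lieBracket X (Y + Z) = lieBracket X Y + lieBracket X Z :=
      (tangentAlgebroid E M).bracket_add X Y Z
    rw [h, map_add, map_add, ← anchor_apply, map_add, anchor_apply, anchor_apply]
    abel
  map_smul' f Y := by
    have h : lieBracket X (f • Y) = f • lieBracket X Y + lieDerivFunction X f • Y :=
      (tangentAlgebroid E M).bracket_smul X f Y
    rw [h, map_add, map_smul, map_smul, map_smul, ← anchor_apply, ← anchor_apply, ← anchor_apply,
      smul_eq_mul, Derivation.leibniz]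
    simp only [smul_eq_mul, RingHom.id_apply]
    ring

lemma lieDerivOneForm_apply (X : SmoothVectorField E M) (α : OneForm E M)
    (Y : SmoothVectorField E M) :
    lieDerivOneForm X α Y = lieDerivFunction X (α Y) - α (lieBracket X Y) := rfl

/-- The bracket `{f, g} = dg((df)^#)` of functions determined by a map `#` from 1-forms to vector fields. -/
def functionBracket (sharp : OneForm E M →ₗ[SmoothFunction E M] SmoothVectorField E M)
    (f g : SmoothFunction E M) : SmoothFunction E M :=
  differentialFunction g (sharp (differentialFunction f))

variable (E M) in
/-- A Poisson structure, given by the map `#` with `β(α^#) = Λ(α, β)`: it is `C^∞(M)`-linear, the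
bilinear map `Λ` is alternating (so `Λ` is a bivector field), and the bracket
`{f, g} = Λ(df, dg)` of functions satisfies the Jacobi identity. -/
structure PoissonStructure where
  sharp : OneForm E M →ₗ[SmoothFunction E M] SmoothVectorField E M
  skew : ∀ α : OneForm E M, α (sharp α) = 0
  jacobi : ∀ f g h : SmoothFunction E M,
    functionBracket sharp (functionBracket sharp f g) h +
      functionBracket sharp (functionBracket sharp g h) f +
      functionBracket sharp (functionBracket sharp h f) g = 0

namespace PoissonStructure

variable (P : PoissonStructure E M)

/-- The Poisson bivector `Λ(α, β) = β(α^#)`. -/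
def bivector (α β : OneForm E M) : SmoothFunction E M := β (P.sharp α)

lemma bivector_skew (α β : OneForm E M) : P.bivector α β = -P.bivector β α := by
  have h := P.skew (α + β)
  rw [map_add, map_add, LinearMap.add_apply, LinearMap.add_apply, P.skew, P.skew, zero_add,
    add_zero] at h
  exact eq_neg_of_add_eq_zero_left h

/-- The bracket of 1-forms `{α, β} = L_{α^#} β - L_{β^#} α - d(Λ(α, β))`. -/
def koszulBracket (α β : OneForm E M) : OneForm E M :=
  lieDerivOneForm (P.sharp α) β - lieDerivOneForm (P.sharp β) α -
    differentialFunction (P.bivector α β)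

/-- 1-forms with the bracket above, acting on functions by `α ↦ α^#`. The associated differential of
multivector fields is the operator `σ` of the Poisson structure:
`(σQ)(α₀, …, α_k) = ∑_i (-1)^i α_i^#(Q(…, α̂_i, …)) + ∑_{i<j} (-1)^(i+j) Q({α_i, α_j}, …)`. -/
def cotangentAlgebroid : AnchoredBracket (SmoothFunction E M) (OneForm E M) where
  anchor := (tangentAlgebroid E M).anchor ∘ₗ P.sharp
  bracket := P.koszulBracket
  bracket_add α β γ := by
    ext1 Y
    simp only [koszulBracket, bivector, LinearMap.sub_apply, LinearMap.add_apply,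
      lieDerivOneForm_apply, map_add, differentialFunction_add]
    have h : lieBracket (P.sharp β + P.sharp γ) Y =
        lieBracket (P.sharp β) Y + lieBracket (P.sharp γ) Y :=
      (tangentAlgebroid E M).add_bracket _ _ _
    rw [h]
    simp only [← anchor_apply, map_add, Derivation.add_apply]
    abel
  bracket_skew α β := by
    have h : differentialFunction (P.bivector α β) = -differentialFunction (P.bivector β α) := by
      rw [P.bivector_skew, differentialFunction_neg]
    rw [koszulBracket, koszulBracket, h]
    abel
  bracket_smul α f β := by
    ext1 Y
    have h : lieBracket (f • P.sharp β) Y =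
        f • lieBracket (P.sharp β) Y - lieDerivFunction Y f • P.sharp β :=
      (tangentAlgebroid E M).smul_bracket _ _ _
    have h2 : α (P.sharp β) = -β (P.sharp α) := P.bivector_skew β α
    simp only [koszulBracket, bivector, LinearMap.sub_apply, LinearMap.add_apply,
      LinearMap.smul_apply, lieDerivOneForm_apply, map_smul, differentialFunction_apply, h,
      map_sub, LinearMap.comp_apply, h2]
    simp only [← anchor_apply, map_smul, smul_eq_mul, Derivation.leibniz, Derivation.smul_apply]
    ring

/-- The Casimir functions: those with trivial Hamiltonian vector field. -/
def casimirs : Subalgebra ℝ (SmoothFunction E M) where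
  carrier := {f | P.sharp (differentialFunction f) = 0}
  mul_mem' := fun {f g} hf hg => by
    rw [Set.mem_ofPred_eq] at hf hg ⊢
    rw [differentialFunction_mul, map_add, map_smul, map_smul, hf, hg, smul_zero, smul_zero,
      add_zero]
  add_mem' := fun {f g} hf hg => by
    rw [Set.mem_ofPred_eq] at hf hg ⊢
    rw [differentialFunction_add, map_add, hf, hg, add_zero]
  algebraMap_mem' := fun c => by
    rw [Set.mem_ofPred_eq, differentialFunction_algebraMap, map_zero]

lemma anchor_casimir {f : SmoothFunction E M} (hf : f ∈ P.casimirs) (α : OneForm E M) :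
    P.cotangentAlgebroid.anchor α f = 0 := by
  have h : P.sharp (differentialFunction f) = 0 := hf
  change P.bivector α (differentialFunction f) = 0
  rw [bivector_skew, bivector, h, map_zero, neg_zero]

/-- The Poisson cohomology `H^k_Λ(M)`: cohomology of the multivector fields with `σ`. -/
abbrev PCohomology (k : ℕ) : Type _ :=
  TotalCohomology P.cotangentAlgebroid P.casimirs (fun _ hf α => P.anchor_casimir hf α) k

/-- The tangent space at `x` of the symplectic leaf through `x`: the image of `#` at `x`. -/
def leafTangent (x : M) : Submodule ℝ (TangentSpace 𝓘(ℝ, E) x) where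
  carrier := {u | ∃ α : OneForm E M, P.sharp α x = u}
  zero_mem' := ⟨0, by rw [map_zero]; rfl⟩
  add_mem' := by
    rintro _ _ ⟨α, rfl⟩ ⟨β, rfl⟩
    exact ⟨α + β, by rw [map_add]; rfl⟩
  smul_mem' := by
    rintro c _ ⟨α, rfl⟩
    exact ⟨algebraMap ℝ (SmoothFunction E M) c • α, by rw [map_smul]; rfl⟩

/-- The Poisson structure is regular of rank `r`. -/
def IsRegularOfRank (r : ℕ) : Prop :=
  ∀ x : M, Module.finrank ℝ (P.leafTangent x) = r

/-- The vector fields tangent to the leaves of the symplectic foliation. -/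
def tangentialFields : Submodule (SmoothFunction E M) (SmoothVectorField E M) where
  carrier := {X | ∀ x, X x ∈ P.leafTangent x}
  zero_mem' := fun x => (P.leafTangent x).zero_mem
  add_mem' := fun hX hY x => (P.leafTangent x).add_mem (hX x) (hY x)
  smul_mem' := fun f _ hX x => (P.leafTangent x).smul_mem (f x) (hX x)

lemma tangential_casimir {f : SmoothFunction E M} (hf : f ∈ P.casimirs)
    {X : SmoothVectorField E M} (hX : X ∈ P.tangentialFields) :
    (tangentAlgebroid E M).anchor X f = 0 := by
  ext x
  obtain ⟨α, hα⟩ := hX x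
  have h := congrArg (fun g : SmoothFunction E M => g x) (P.anchor_casimir hf α)
  rw [anchor_apply, lieDerivFunction_apply, ← hα]
  exact h

/-- The 1-form `β` defines the symplectic foliation: at every point its kernel is the tangent space of
the leaf. -/
def DefinesFoliation (β : DifferentialForm E M 1) : Prop :=
  ∀ (X : SmoothVectorField E M) (x : M), β (fun _ => X) x = 0 ↔ X x ∈ P.leafTangent x

/-- A smooth distribution complementary to the symplectic foliation; smoothness says that the
projection of a smooth vector field is smooth. -/
structure TransversalDistribution where
  fiber : ∀ x : M, Submodule ℝ (TangentSpace 𝓘(ℝ, E) x)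
  isCompl_fiber : ∀ x, IsCompl (P.leafTangent x) (fiber x)
  smooth : ∀ X : SmoothVectorField E M, ∃ Y : SmoothVectorField E M,
    ∀ x, Y x ∈ fiber x ∧ X x - Y x ∈ P.leafTangent x

namespace TransversalDistribution

variable {P} (ν : P.TransversalDistribution)

/-- The vector fields with values in the transversal distribution. -/
def fields : Submodule (SmoothFunction E M) (SmoothVectorField E M) where
  carrier := {X | ∀ x, X x ∈ ν.fiber x}
  zero_mem' := fun x => (ν.fiber x).zero_mem
  add_mem' := fun hX hY x => (ν.fiber x).add_mem (hX x) (hY x)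
  smul_mem' := fun f _ hX x => (ν.fiber x).smul_mem (f x) (hX x)

lemma isCompl_fields : IsCompl P.tangentialFields ν.fields := by
  constructor
  · rw [Submodule.disjoint_def]
    intro X hT hN
    ext x
    exact (Submodule.disjoint_def.1 (ν.isCompl_fiber x).disjoint) _ (hT x) (hN x)
  · rw [codisjoint_iff, Submodule.eq_top_iff']
    intro X
    obtain ⟨Y, hY⟩ := ν.smooth X
    exact Submodule.mem_sup.2 ⟨X - Y, fun x => (hY x).2, Y, fun x => (hY x).1, sub_add_cancel X Y⟩

lemma isCompl_annihilators :
    IsCompl ν.fields.dualAnnihilator P.tangentialFields.dualAnnihilator := by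
  have h := ν.isCompl_fields
  constructor
  · rw [Submodule.disjoint_def]
    intro α hN hT
    rw [Submodule.mem_dualAnnihilator] at hN hT
    ext1 X
    obtain ⟨Y, hY, Z, hZ, rfl⟩ := Submodule.mem_sup.1 (h.sup_eq_top.symm ▸ Submodule.mem_top :
      X ∈ P.tangentialFields ⊔ ν.fields)
    rw [map_add, hT Y hY, hN Z hZ]
    simp
  · rw [codisjoint_iff, Submodule.eq_top_iff']
    intro α
    refine Submodule.mem_sup.2 ⟨α ∘ₗ P.tangentialFields.projection ν.fields h, ?_,
      α ∘ₗ ν.fields.projection P.tangentialFields h.symm, ?_, ?_⟩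
    · rw [Submodule.mem_dualAnnihilator]
      intro X hX
      rw [LinearMap.comp_apply, (Submodule.projection_apply_eq_zero_iff h).2 hX, map_zero]
    · rw [Submodule.mem_dualAnnihilator]
      intro X hX
      rw [LinearMap.comp_apply, (Submodule.projection_apply_eq_zero_iff h.symm).2 hX, map_zero]
    · ext1 X
      rw [LinearMap.add_apply, LinearMap.comp_apply, LinearMap.comp_apply, ← map_add,
        Submodule.projection_add_projection_eq_self]

/-- The tangential Poisson cohomology `H^q_{Λ,tan}(M)`: the cohomology of the tangential multivector
fields (type `(0, q)`: they vanish if an argument annihilates the leaves) with the tangential part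
`σ''` of `σ`. Tangential covectors are those that annihilate the transversal distribution,
transversal ones those that annihilate the leaves. -/
abbrev TPCohomology (q : ℕ) : Type _ :=
  LeafCohomology P.cotangentAlgebroid ν.isCompl_annihilators P.casimirs
    (fun _ hf α _ => P.anchor_casimir hf α) 0 q

/-- The cohomology `H^q(M, P^p(F))` with values in the projectable `p`-forms of the foliation:
the cohomology at `Ω_{p,q}` of the forms with `p` transversal arguments and `q` tangential ones, with
the leafwise exterior derivative `d''`, the part of type `(0, 1)` of `d`. -/
abbrev ProjectableCohomology (q p : ℕ) : Type _ :=
  LeafCohomology (tangentAlgebroid E M) ν.isCompl_fields P.casimirs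
    (fun _ hf _ hX => P.tangential_casimir hf hX) p (q + p)

/-- The subspace `σ(V_{1,0})` of the second tangential Poisson cohomology: the classes of those bivector
fields `σ(V)`, `V` with values in the transversal distribution, which are tangential. -/
def sigmaTransversal : Submodule P.casimirs (ν.TPCohomology 2) :=
  transverseClasses P.cotangentAlgebroid ν.isCompl_annihilators P.casimirs
    (fun _ hf α _ => P.anchor_casimir hf α) (fun _ hf α => P.anchor_casimir hf α) 1

end TransversalDistribution
end PoissonStructure
end Geometry
end PoissonGeom
end

open PoissonGeom

/-! Since `νF` is a line bundle on which `β` does not vanish, it has a section `Y` with `β(Y) = 1`.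
Dually, the 1-forms split as `T ⊕ span β`, where `T` is the annihilator of `νF`. Because `β`
annihilates the leaves, `β^# = 0`, and because `dβ = 0`, `{β, α} = -L_{α^#} β = 0` for every `α`. So
`β` is a central element with zero anchor in the algebra of 1-forms (`koszulBracket_form`).

A multivector field is determined by its restriction to `T` and its contraction with `β`, restricted
to `T`. Centrality makes this contraction anticommute with `σ` (`contract_differential_of_central`)
and makes `σ` preserve the tangential multivector fields. Up to sign this gives a short exact
sequence of cochains `0 → V_{0,k} → V^k → C^{k-1}(T) → 0`, where `C` denotes the alternating maps on
`T` with the bracket projected to `T`. As the leaves are surfaces, `C^3(T) = 0`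
(`alternatingMap_three_eq_zero`). Hence in degree 3 contraction is an isomorphism onto `C^2(T)`. In
degree 2 the obstruction to lifting classes of `C^1(T)` vanishes, and what dies in the tangential
cohomology is exactly `σ(V_{1,0})`. The resulting exact sequence is split over the reals
(`exists_totalCohomologyTwoEquiv`).

It remains to recognise the cohomology of `C(T)`. Restriction to `T` identifies it with the
tangential Poisson cohomology (`leafCohomologyZeroEquiv`). On the other side, contraction with `Y`
identifies `Ω_{1,q}` with the leafwise `q`-forms; it anticommutes with `d''` because `dβ = 0` and
`β(Y) = 1` give `[Y, TF] ⊂ TF` (`leafCohomologyOneEquiv`). Finally `#` is an isomorphism from `T` to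
the tangential fields, and it respects brackets because the leafwise symplectic form is closed
(`sharp_koszulBracket`). -/

noncomputable section
namespace PoissonGeom

/-! ### Tensoriality: pointwise values of vector fields and 1-forms -/

section SmoothSections
variable {E : Type*} [NormedAddCommGroup E] [NormedSpace ℝ E] [FiniteDimensional ℝ E]
  {M : Type*} [TopologicalSpace M] [ChartedSpace E M] [IsManifold 𝓘(ℝ, E) ∞ M]

lemma contMDiffVectorBundle_tangent :
    ContMDiffVectorBundle ∞ E (TangentSpace 𝓘(ℝ, E) : M → Type _) 𝓘(ℝ, E) := by
  have : IsManifold 𝓘(ℝ, E) (∞ + 1) M := by simpa using ‹IsManifold 𝓘(ℝ, E) ∞ M›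
  exact TangentBundle.contMDiffVectorBundle

/-- A local frame and its coefficient functionals are both cut off by one bump function `f`, whence
`φ = f * f`. This stands in for a global frame: applying a `C^∞(M)`-linear map to the identity shows
that its value at `x` depends only on `X x`. -/
lemma exists_smul_eq_sum_smul [T2Space M] (x : M) :
    ∃ (n : ℕ) (e : Fin n → SmoothVectorField E M) (δ : Fin n → OneForm E M)
      (φ : SmoothFunction E M), φ x = 1 ∧ (∀ X : SmoothVectorField E M, φ • X = ∑ i, δ i X • e i) ∧
        ∀ X : SmoothVectorField E M, X x = 0 → ∀ i, δ i X x = 0 := by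
  have := contMDiffVectorBundle_tangent (E := E) (M := M)
  have : ContMDiffVectorBundle 1 E (TangentSpace 𝓘(ℝ, E) : M → Type _) 𝓘(ℝ, E) :=
    ContMDiffVectorBundle.of_le (n := ∞) (by norm_cast)
  let t := trivializationAt E (TangentSpace 𝓘(ℝ, E) : M → Type _) x
  have hx : x ∈ t.baseSet := FiberBundle.mem_baseSet_trivializationAt E _ x
  obtain ⟨f, hf, -⟩ := (SmoothBumpFunction.nhds_basis_support (I := 𝓘(ℝ, E))
    (t.open_baseSet.mem_nhds hx)).mem_iff.1 (t.open_baseSet.mem_nhds hx)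
  let b := Module.finBasis ℝ E
  have hf0 : ∀ y, y ∉ t.baseSet → f y = 0 := fun y hy =>
    image_eq_zero_of_notMem_tsupport fun h => hy (hf h)
  let g : SmoothFunction E M := ⟨f, f.contMDiff⟩
  let e : Fin (Module.finrank ℝ E) → SmoothVectorField E M := fun i =>
    ⟨(f : M → ℝ) • t.localFrame b i, ContMDiffOn.smul_section_of_tsupport
      f.contMDiff.contMDiffOn t.open_baseSet hf (t.contMDiffOn_localFrame_baseSet ∞ b i)⟩
  let δ : Fin (Module.finrank ℝ E) → OneForm E M := fun i =>
    { toFun := fun X => ⟨fun y => f y • t.localFrameCoeff 𝓘(ℝ, E) b i y (X y),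
        contMDiff_of_tsupport fun y hy => by
          refine f.contMDiff.contMDiffAt.smul ?_
          exact contMDiffAt_localFrameCoeff b (hf (tsupport_smul_subset_left _ _ hy))
            X.contMDiff.contMDiffAt i⟩
      map_add' := fun X Y => by
        ext y
        change f y • t.localFrameCoeff 𝓘(ℝ, E) b i y (X y + Y y) = _
        rw [map_add, smul_add]; rfl
      map_smul' := fun h X => by
        ext y
        change f y • t.localFrameCoeff 𝓘(ℝ, E) b i y (h y • X y) = _
        rw [map_smul, smul_comm]; rfl }
  refine ⟨_, e, δ, g * g, ?_, ?_, ?_⟩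
  · change f x * f x = 1
    simp
  · intro X
    ext y
    have h1 : (∑ i, δ i X • e i) y = ∑ i, (f y • t.localFrameCoeff 𝓘(ℝ, E) b i y (X y)) •
        (f y • t.localFrame b i y) := by
      rw [show ∀ s : Finset (Fin (Module.finrank ℝ E)), (∑ i ∈ s, δ i X • e i) y =
        ∑ i ∈ s, (δ i X • e i) y from fun s => by
          induction s using Finset.cons_induction with
          | empty => rfl
          | cons a s ha ih => rw [Finset.sum_cons, Finset.sum_cons, ← ih]; rfl]
      rfl
    rw [h1]
    change (f y * f y) • X y = _
    by_cases hy : y ∈ t.baseSet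
    · conv_lhs => rw [t.eq_sum_localFrameCoeff_smul (I := 𝓘(ℝ, E)) (b := b) (s := fun z => X z) hy]
      rw [Finset.smul_sum]
      refine Finset.sum_congr rfl fun i _ => ?_
      simp only [smul_smul, smul_eq_mul]
      congr 1
      ring
    · simp [hf0 y hy]
  · intro X hX i
    change f x • t.localFrameCoeff 𝓘(ℝ, E) b i x (X x) = 0
    rw [hX, map_zero, smul_zero]

lemma sum_function_apply {ι : Type*} (s : Finset ι) (f : ι → SmoothFunction E M) (x : M) :
    (∑ i ∈ s, f i) x = ∑ i ∈ s, f i x := by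
  induction s using Finset.cons_induction with
  | empty => rfl
  | cons a s ha ih => rw [Finset.sum_cons, Finset.sum_cons, ← ih]; rfl

lemma oneForm_apply_eq_zero [T2Space M] (α : OneForm E M) {X : SmoothVectorField E M} {x : M}
    (h : X x = 0) : α X x = 0 := by
  obtain ⟨n, e, δ, φ, hφ, hX, hδ⟩ := exists_smul_eq_sum_smul (E := E) x
  have h1 := congrArg (fun g : SmoothFunction E M => g x) (congrArg α (hX X))
  simp only [map_smul, map_sum, sum_function_apply] at h1
  change φ x * α X x = ∑ i, δ i X x * α (e i) x at h1
  simpa [hφ, hδ X h] using h1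

lemma oneForm_apply_congr [T2Space M] (α : OneForm E M) {X Y : SmoothVectorField E M} {x : M}
    (h : X x = Y x) : α X x = α Y x := by
  have h1 : α (X - Y) x = 0 := oneForm_apply_eq_zero α (sub_eq_zero.2 h)
  rw [map_sub] at h1
  exact sub_eq_zero.1 h1

lemma vectorField_apply_eq_zero [T2Space M] {X : SmoothVectorField E M} {x : M}
    (h : ∀ α : OneForm E M, α X x = 0) : X x = 0 := by
  obtain ⟨n, e, δ, φ, hφ, hX, hδ⟩ := exists_smul_eq_sum_smul (E := E) x
  have h2 : X x = (φ • X) x := by rw [smul_vectorField_apply, hφ, one_smul]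
  rw [h2, hX X]
  refine Finset.sum_induction (fun i => δ i X • e i) (fun Y : SmoothVectorField E M => Y x = 0)
    (fun Y Z hY hZ => ?_) rfl (fun i _ => ?_)
  · change Y x + Z x = 0
    rw [hY, hZ, add_zero]
  · rw [smul_vectorField_apply, h, zero_smul]

lemma vectorField_eq_of_oneForm [T2Space M] {X Y : SmoothVectorField E M}
    (h : ∀ α : OneForm E M, α X = α Y) : X = Y := by
  rw [← sub_eq_zero]
  ext x
  refine vectorField_apply_eq_zero fun α => ?_
  rw [map_sub, h, sub_self]
  rfl

lemma exists_vectorField_apply [T2Space M] (x : M) (u : TangentSpace 𝓘(ℝ, E) x) :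
    ∃ X : SmoothVectorField E M, X x = u := by
  have := contMDiffVectorBundle_tangent (E := E) (M := M)
  obtain ⟨s, hs, h⟩ := FiberBundle.exists_contMDiffOn_extend (k := ∞) 𝓘(ℝ, E) E u
  obtain ⟨f, hf, -⟩ := (SmoothBumpFunction.nhds_basis_support (I := 𝓘(ℝ, E))
    (interior_mem_nhds.2 hs)).mem_iff.1 hs
  refine ⟨⟨(f : M → ℝ) • FiberBundle.extend E u, ContMDiffOn.smul_section_of_tsupport
    f.contMDiff.contMDiffOn isOpen_interior hf (h.mono interior_subset)⟩, ?_⟩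
  change f x • FiberBundle.extend E u x = u
  simp

end SmoothSections

/-! ### Rank two: the leafwise symplectic form and the unit transversal field -/

namespace PoissonStructure
variable {E : Type*} [NormedAddCommGroup E] [NormedSpace ℝ E] [FiniteDimensional ℝ E]
  {M : Type*} [TopologicalSpace M] [ChartedSpace E M] [IsManifold 𝓘(ℝ, E) ∞ M] [T2Space M]
  (P : PoissonStructure E M)

lemma sharp_mem_tangentialFields (α : OneForm E M) : P.sharp α ∈ P.tangentialFields :=
  fun _ => ⟨α, rfl⟩

lemma oneForm_sharp (α γ : OneForm E M) : α (P.sharp γ) = -γ (P.sharp α) :=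
  P.bivector_skew γ α

/-- If `Z = η^#` at `x`, then `γ(Z) = -η(γ^#)` there. So the leafwise symplectic form `ω(γ^#, Z) =
γ(Z)` is well defined. -/
lemma oneForm_apply_congr_of_sharp {γ δ : OneForm E M} {Z : SmoothVectorField E M} {x : M}
    (h : P.sharp γ x = P.sharp δ x) (hZ : Z x ∈ P.leafTangent x) : γ Z x = δ Z x := by
  obtain ⟨η, hη⟩ := hZ
  rw [← oneForm_apply_congr γ hη, ← oneForm_apply_congr δ hη, P.oneForm_sharp, P.oneForm_sharp δ]
  exact congrArg Neg.neg (oneForm_apply_congr η h)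

lemma exists_bivector_ne_zero (hP : P.IsRegularOfRank 2) (x : M) :
    ∃ α γ : OneForm E M, P.bivector α γ x ≠ 0 := by
  have : Nontrivial (P.leafTangent x) :=
    Module.nontrivial_of_finrank_pos (R := ℝ) (by rw [hP x]; norm_num)
  obtain ⟨⟨_, α, rfl⟩, hα⟩ := exists_ne (0 : P.leafTangent x)
  by_contra! h
  exact hα (Subtype.ext (vectorField_apply_eq_zero fun γ => h α γ))

/-- Three tangential vector fields of a foliation by surfaces are linearly dependent. -/
lemma bivector_smul (hP : P.IsRegularOfRank 2) (α γ : OneForm E M) {X : SmoothVectorField E M}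
    (hX : X ∈ P.tangentialFields) :
    P.bivector α γ • X = γ X • P.sharp α - α X • P.sharp γ := by
  ext x
  obtain ⟨η, hη⟩ := hX x
  let w : Fin 3 → P.leafTangent x := ![⟨X x, hX x⟩, ⟨P.sharp α x, α, rfl⟩, ⟨P.sharp γ x, γ, rfl⟩]
  have : FiniteDimensional ℝ (TangentSpace 𝓘(ℝ, E) x) := inferInstanceAs (FiniteDimensional ℝ E)
  have hw : ¬ LinearIndependent ℝ w := fun h => by
    have := h.fintype_card_le_finrank
    rw [hP x, Fintype.card_fin] at this
    omega
  obtain ⟨c, hc, i, hi⟩ := Fintype.not_linearIndependent_iff.1 hw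
  rw [Fin.sum_univ_three] at hc
  have hc' : c 0 • X x + c 1 • P.sharp α x + c 2 • P.sharp γ x = 0 := congrArg Subtype.val hc
  -- The dependence relation is paired with `α`, with `γ`, and with a form `η` such that `η^# = X`
  -- at `x`; skew-symmetry kills one term each time.
  have key : ∀ θ : OneForm E M, c 0 * θ X x + c 1 * θ (P.sharp α) x + c 2 * θ (P.sharp γ) x = 0 := by
    intro θ
    let a : Fin 3 → SmoothFunction E M := fun i => algebraMap ℝ _ (c i)
    have h := oneForm_apply_eq_zero θ (X := a 0 • X + a 1 • P.sharp α + a 2 • P.sharp γ) hc'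
    rw [map_add, map_add, map_smul, map_smul, map_smul] at h
    exact h
  have hα : c 0 * α X x - c 2 * P.bivector α γ x = 0 := by
    have := key α
    rw [P.skew, P.oneForm_sharp α] at this
    change c 0 * α X x + c 1 * 0 + c 2 * -P.bivector α γ x = 0 at this
    linarith
  have hγ : c 0 * γ X x + c 1 * P.bivector α γ x = 0 := by
    have := key γ
    rw [P.skew] at this
    change c 0 * γ X x + c 1 * P.bivector α γ x + c 2 * 0 = 0 at this
    linarith
  have hη' : c 1 * α X x + c 2 * γ X x = 0 := by
    have h0 : ∀ θ : OneForm E M, η (P.sharp θ) x = -θ X x := fun θ => by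
      rw [P.oneForm_sharp, ← oneForm_apply_congr θ hη]; rfl
    have h1 := key η
    rw [h0, h0, oneForm_apply_congr η hη.symm, P.skew] at h1
    change c 0 * 0 + c 1 * -α X x + c 2 * -γ X x = 0 at h1
    linarith
  change P.bivector α γ x • X x = γ X x • P.sharp α x - α X x • P.sharp γ x
  generalize P.bivector α γ x = l at *
  generalize α X x = s at *
  generalize γ X x = t at *
  generalize P.sharp α x = u at *
  generalize P.sharp γ x = v at *
  generalize X x = z at *
  rw [← sub_eq_zero]
  -- If `c 0 ≠ 0`, the relation is solved for `X`. Otherwise `α^#` and `γ^#` are dependent at the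
  -- point, so `l = 0`, and the right-hand side vanishes because `(s, t)` satisfies the same
  -- relation as `(u, v)`.
  by_cases h0 : c 0 = 0
  · rw [h0, zero_smul, zero_add] at hc'
    have hi' : c 1 ≠ 0 ∨ c 2 ≠ 0 := by
      by_contra! h
      fin_cases i
      exacts [hi h0, hi h.1, hi h.2]
    have hl : l = 0 := by
      rcases hi' with h | h
      · simpa [h0, h] using hγ
      · simpa [h0, h] using hα
    rw [hl]
    rcases hi' with h | h
    · refine (smul_eq_zero_iff_right h).1 ?_
      linear_combination (norm := module) (-t) • hc' + hη' • v
    · refine (smul_eq_zero_iff_right h).1 ?_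
      linear_combination (norm := module) s • hc' - hη' • u
  · refine (smul_eq_zero_iff_right h0).1 ?_
    linear_combination (norm := module) l • hc' - hγ • u + hα • v

/-- Where `Λ(α, γ) ≠ 0`, division by it yields an explicit smooth preimage of `X` under `#`; this is
the source of all smoothness of the leafwise symplectic form. -/
lemma sharp_bivector (hP : P.IsRegularOfRank 2) (α γ : OneForm E M) {X : SmoothVectorField E M}
    (hX : X ∈ P.tangentialFields) :
    P.sharp (γ X • α - α X • γ) = P.bivector α γ • X := by
  rw [map_sub, map_smul, map_smul, P.bivector_smul hP α γ hX]

/-- The leafwise symplectic form evaluated on two tangential vector fields. -/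
lemma exists_symplecticForm (hP : P.IsRegularOfRank 2) {X Z : SmoothVectorField E M}
    (hX : X ∈ P.tangentialFields) (hZ : Z ∈ P.tangentialFields) :
    ∃ g : SmoothFunction E M, ∀ (x : M) (γ : OneForm E M), P.sharp γ x = X x → γ Z x = g x := by
  -- The forms `γ x` are chosen separately at each point, with no smooth dependence on `x`.
  -- Smoothness is recovered near a point by writing the function as a quotient with denominator
  -- `Λ(α, δ)`.
  choose γ hγ using hX
  refine ⟨⟨fun x => γ x Z x, fun x => ?_⟩, fun x δ hδ =>
    P.oneForm_apply_congr_of_sharp (hδ.trans (hγ x).symm) (hZ x)⟩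
  obtain ⟨α, δ, h⟩ := P.exists_bivector_ne_zero hP x
  have hs : ContMDiffAt 𝓘(ℝ, E) 𝓘(ℝ, ℝ) ∞
      (fun y => (δ X • α - α X • δ) Z y / P.bivector α δ y) x :=
    ((δ X • α - α X • δ) Z).contMDiff.contMDiffAt.div₀ (P.bivector α δ).contMDiff.contMDiffAt h
  refine hs.congr_of_eventuallyEq ?_
  filter_upwards [(P.bivector α δ).contMDiff.continuous.continuousAt.eventually_ne h] with y hy
  rw [eq_div_iff hy, mul_comm]
  -- At `y` both forms are sent by `#` to `Λ(α, δ) X`, so they agree on the tangential vector `Z y`.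
  have e : P.sharp (algebraMap ℝ (SmoothFunction E M) (P.bivector α δ y) • γ y) y =
      P.sharp (δ X • α - α X • δ) y := by
    rw [P.sharp_bivector hP α δ (fun z => ⟨γ z, hγ z⟩), map_smul]
    change P.bivector α δ y • P.sharp (γ y) y = P.bivector α δ y • X y
    rw [hγ]
  exact P.oneForm_apply_congr_of_sharp e (hZ y)

namespace TransversalDistribution
variable {P} (ν : P.TransversalDistribution)

/-- Every tangential vector field is `γ^#` for a tangential 1-form `γ`. -/
lemma exists_sharp_eq (hP : P.IsRegularOfRank 2) {X : SmoothVectorField E M}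
    (hX : X ∈ P.tangentialFields) : ∃ γ ∈ ν.fields.dualAnnihilator, P.sharp γ = X := by
  choose g hg using fun (Z : SmoothVectorField E M) (hZ : Z ∈ P.tangentialFields) =>
    P.exists_symplecticForm hP hX hZ
  have hT := fun Z => Submodule.projection_apply_mem ν.isCompl_fields Z
  -- This is `ω(X, ·)` preceded by the projection along `ν`, so it kills `ν`. At each point its
  -- values on tangential fields are those of any `η` with `η^# = X` there, which gives linearity.
  let γ : OneForm E M :=
    { toFun := fun Z => g (P.tangentialFields.projection ν.fields ν.isCompl_fields Z) (hT Z)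
      map_add' := fun Y Z => by
        ext x
        obtain ⟨η, hη⟩ := hX x
        change _ = g _ _ x + g _ _ x
        rw [← hg _ _ x η hη, ← hg _ _ x η hη, ← hg _ _ x η hη, map_add, map_add]
        rfl
      map_smul' := fun f Z => by
        ext x
        obtain ⟨η, hη⟩ := hX x
        change _ = f x * g _ _ x
        rw [← hg _ _ x η hη, ← hg _ _ x η hη, map_smul, map_smul]
        rfl }
  refine ⟨γ, (Submodule.mem_dualAnnihilator _).2 fun Z hZ => ?_, vectorField_eq_of_oneForm fun δ => ?_⟩
  · ext x
    obtain ⟨η, hη⟩ := hX x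
    change g _ _ x = 0
    rw [← hg _ _ x η hη, (Submodule.projection_apply_eq_zero_iff ν.isCompl_fields).2 hZ, map_zero]
    rfl
  · rw [P.oneForm_sharp]
    ext x
    obtain ⟨η, hη⟩ := hX x
    change -g _ _ x = _
    rw [← hg _ _ x η hη, Submodule.projection_apply_of_mem_left ν.isCompl_fields
      (P.sharp_mem_tangentialFields δ), P.oneForm_sharp, ← oneForm_apply_congr δ hη]
    exact neg_neg _

/-- The difference of the two sides lies in `ν` and is killed by `β`, hence is also tangential,
hence zero. In other words, the transversal distribution has rank at most one. -/
lemma oneForm_smul_comm {β : OneForm E M}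
    (hβ : ∀ (X : SmoothVectorField E M) (x : M), β X x = 0 ↔ X x ∈ P.leafTangent x)
    {V W : SmoothVectorField E M} (hV : V ∈ ν.fields) (hW : W ∈ ν.fields) :
    β V • W = β W • V := by
  rw [← sub_eq_zero]
  refine (Submodule.disjoint_def.1 ν.isCompl_fields.disjoint) _ (fun x => (hβ _ x).1 ?_)
    (sub_mem (Submodule.smul_mem _ _ hW) (Submodule.smul_mem _ _ hV))
  rw [map_sub, map_smul, map_smul, smul_eq_mul, smul_eq_mul, mul_comm, sub_self]
  rfl

/-- A transversal distribution of a foliation defined by the 1-form `β` is spanned by a vector field on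
which `β` is `1`. -/
lemma exists_oneForm_apply_eq_one {β : OneForm E M}
    (hβ : ∀ (X : SmoothVectorField E M) (x : M), β X x = 0 ↔ X x ∈ P.leafTangent x)
    (hP : ∀ x : M, P.leafTangent x ≠ ⊤) : ∃ Y ∈ ν.fields, β Y = 1 := by
  have h1 : ∀ x : M, ∃ W ∈ ν.fields, β W x ≠ 0 := by
    intro x
    obtain ⟨u, hu⟩ := SetLike.exists_not_mem_of_ne_top _ (hP x)
    obtain ⟨X, rfl⟩ := exists_vectorField_apply x u
    obtain ⟨W, hW⟩ := ν.smooth X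
    refine ⟨W, fun y => (hW y).1, fun h => hu ?_⟩
    have := add_mem (hW x).2 ((hβ W x).1 h)
    rwa [sub_add_cancel] at this
  choose W hW hW0 using h1
  -- The normalised vector at `y` is the same whichever transversal field with `β ≠ 0` at `y` is
  -- used. Near `x` it can therefore be computed from the single field `W x`, which makes it smooth.
  have hpt : ∀ V ∈ ν.fields, ∀ y, β V y • ((β (W y) y)⁻¹ • W y y) = V y := by
    intro V hV y
    have h := congrArg (fun Z : SmoothVectorField E M => Z y) (ν.oneForm_smul_comm hβ hV (hW y))
    change β V y • W y y = β (W y) y • V y at h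
    rw [smul_comm, h, smul_smul, inv_mul_cancel₀ (hW0 y), one_smul]
  have hsm : ContMDiff 𝓘(ℝ, E) (𝓘(ℝ, E).prod 𝓘(ℝ, E)) ∞ (fun y => (Bundle.TotalSpace.mk' E y
      ((β (W y) y)⁻¹ • W y y) : TangentBundle 𝓘(ℝ, E) M)) := by
    intro x
    have hs := ((β (W x)).contMDiff.contMDiffAt.inv₀ (hW0 x)).smul_section
      (W x).contMDiff.contMDiffAt
    refine hs.congr_of_eventuallyEq ?_
    filter_upwards [(β (W x)).contMDiff.continuous.continuousAt.eventually_ne (hW0 x)] with y hy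
    change Bundle.TotalSpace.mk' E y _ = Bundle.TotalSpace.mk' E y ((β (W x) y)⁻¹ • W x y)
    congr 1
    rw [eq_inv_smul_iff₀ hy, hpt _ (hW x)]
  let Y : SmoothVectorField E M := ⟨fun y => (β (W y) y)⁻¹ • W y y, hsm⟩
  refine ⟨Y, fun x => (ν.fiber x).smul_mem _ (hW x x), ?_⟩
  ext x
  have h2 : β (W x) • Y = W x := by ext y; exact hpt _ (hW x) y
  have h3 := congrArg (fun Z => β Z x) h2
  simp only [map_smul] at h3
  exact mul_left_cancel₀ (hW0 x) (h3.trans (mul_one _).symm)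

end TransversalDistribution
end PoissonStructure

/-! ### Alternating maps on a module with a free complement of rank one -/

section LineComplement
variable {A L : Type*} [CommRing A] [AddCommGroup L] [Module A L]

/-- A decomposition `L = T ⊕ N` in which `N` is free on one generator. -/
structure LineComplement (T N : Submodule A L) where
  isCompl : IsCompl T N
  gen : L
  gen_mem : gen ∈ N
  coord : L →ₗ[A] A
  coord_of_mem : ∀ t ∈ T, coord t = 0
  coord_gen : coord gen = 1
  coord_smul_gen : ∀ v ∈ N, coord v • gen = v

/-- The restriction of an alternating map to a submodule. -/
def restrictTo (T : Submodule A L) (k : ℕ) : (L [⋀^Fin k]→ₗ[A] A) →ₗ[A] (T [⋀^Fin k]→ₗ[A] A) where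
  toFun Q := Q.compLinearMap T.subtype
  map_add' _ _ := rfl
  map_smul' _ _ := rfl

lemma restrictTo_apply {T : Submodule A L} {k : ℕ} (Q : L [⋀^Fin k]→ₗ[A] A) (t : Fin k → T) :
    restrictTo T k Q t = Q (fun i => t i) := rfl

/-- The extension by zero of an alternating map on `T` along the complement `N`. -/
def extendAlong {T N : Submodule A L} (h : IsCompl T N) {k : ℕ} (q : T [⋀^Fin k]→ₗ[A] A) :
    L [⋀^Fin k]→ₗ[A] A := q.compLinearMap (T.projectionOnto N h)

lemma extendAlong_apply {T N : Submodule A L} (h : IsCompl T N) {k : ℕ} (q : T [⋀^Fin k]→ₗ[A] A)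
    (v : Fin k → L) : extendAlong h q v = q (fun i => T.projectionOnto N h (v i)) := rfl

lemma restrictTo_extendAlong {T N : Submodule A L} (h : IsCompl T N) {k : ℕ}
    (q : T [⋀^Fin k]→ₗ[A] A) : restrictTo T k (extendAlong h q) = q := by
  ext t
  simp [restrictTo_apply, extendAlong_apply]

lemma apply_eq_zero_of_mem_ofType {T N : Submodule A L} {k : ℕ} {Q : L [⋀^Fin k]→ₗ[A] A}
    (hQ : Q ∈ ofType T N 1 k) (v : Fin k → L) (hv : ∀ i, v i ∈ T) : Q v = 0 :=
  hQ v ∅ (by simp) (fun i _ => hv i) (by simp)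

lemma restrictTo_eq_zero_of_mem_ofType {T N : Submodule A L} {k : ℕ} {Q : L [⋀^Fin k]→ₗ[A] A}
    (hQ : Q ∈ ofType T N 1 k) : restrictTo T k Q = 0 := by
  ext t
  exact apply_eq_zero_of_mem_ofType hQ _ fun i => (t i).2

lemma component_apply_of_homogeneous {T N : Submodule A L} (h : IsCompl T N) {p k : ℕ}
    (θ : L [⋀^Fin k]→ₗ[A] A) {v : Fin k → L} {S : Finset (Fin k)} (hN : ∀ i ∈ S, v i ∈ N)
    (hT : ∀ i ∉ S, v i ∈ T) (hS : S.card = p) : component h p k θ v = θ v := by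
  rw [component_apply, Finset.sum_eq_single S]
  · congr 1
    funext i
    by_cases hi : i ∈ S
    · rw [splitArgs, if_pos hi, Submodule.projection_apply_of_mem_left _ (hN i hi)]
    · rw [splitArgs, if_neg hi, Submodule.projection_apply_of_mem_left _ (hT i hi)]
  · intro R hR hRS
    obtain ⟨i, hiR, hiS⟩ : ∃ i ∈ R, i ∉ S := by
      by_contra! hc
      exact hRS (Finset.eq_of_subset_of_card_le hc
        (hS.trans (Finset.mem_powersetCard.1 hR).2.symm).le)
    refine θ.map_coord_zero i ?_
    rw [splitArgs, if_pos hiR, Submodule.projection_apply_eq_zero_iff]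
    exact hT i hiS
  · intro hS'
    exact (hS' (Finset.mem_powersetCard.2 ⟨Finset.subset_univ _, hS⟩)).elim

lemma restrictTo_component {T N : Submodule A L} (h : IsCompl T N) {k : ℕ}
    (θ : L [⋀^Fin k]→ₗ[A] A) : restrictTo T k (component h 0 k θ) = restrictTo T k θ := by
  ext t
  exact component_apply_of_homogeneous h θ (S := ∅) (by simp) (fun i _ => (t i).2) rfl

namespace LineComplement
variable {T N : Submodule A L} (c : LineComplement T N) {k : ℕ}

/-- The contraction of an alternating map with the generator of the complement, restricted to `T`. -/
def contract (k : ℕ) : (L [⋀^Fin (k + 1)]→ₗ[A] A) →ₗ[A] (T [⋀^Fin k]→ₗ[A] A) where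
  toFun Q := restrictTo T k (Q.curryLeft c.gen)
  map_add' _ _ := rfl
  map_smul' _ _ := rfl

lemma contract_apply (Q : L [⋀^Fin (k + 1)]→ₗ[A] A) (t : Fin k → T) :
    c.contract k Q t = Q (Fin.cons c.gen fun i => (t i : L)) := rfl

lemma eq_projection_add (v : L) :
    v = T.projection N c.isCompl v + c.coord v • c.gen := by
  have h1 := Submodule.projection_add_projection_eq_self c.isCompl v
  have h2 : c.coord v = c.coord (N.projection T c.isCompl.symm v) := by
    conv_lhs => rw [← h1]
    rw [map_add, c.coord_of_mem _ (Submodule.projection_apply_mem _ _), zero_add]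
  rw [h2, c.coord_smul_gen _ (Submodule.projection_apply_mem _ _), h1]

/-- Each argument is written as its `T`-part plus a multiple of the generator; in the multilinear
expansion every term but the one with only `T`-parts has the generator in some slot. -/
lemma apply_projection {Q : L [⋀^Fin k]→ₗ[A] A} (hQ : ∀ v i, v i = c.gen → Q v = 0)
    (v : Fin k → L) : Q v = restrictTo T k Q (fun i => T.projectionOnto N c.isCompl (v i)) := by
  classical
  rw [restrictTo_apply]
  have hv : v = (fun i => T.projection N c.isCompl (v i)) + fun i => c.coord (v i) • c.gen :=
    funext fun i => c.eq_projection_add (v i)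
  conv_lhs => rw [hv]
  change Q.toMultilinearMap _ = _
  rw [MultilinearMap.map_add_univ, Finset.sum_eq_single Finset.univ]
  · rw [Finset.piecewise_univ]; rfl
  · intro S _ hS
    obtain ⟨i, hi⟩ : ∃ i, i ∉ S := by
      by_contra! hc
      exact hS (Finset.eq_univ_iff_forall.2 hc)
    have h := Q.map_update_smul (S.piecewise (fun i => T.projection N c.isCompl (v i))
      (fun i => c.coord (v i) • c.gen)) i (c.coord (v i)) c.gen
    rw [hQ _ i (Function.update_self _ _ _), smul_zero] at h
    rw [← h]
    change Q _ = Q _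
    congr 1
    rw [Function.eq_update_self_iff, Finset.piecewise_eq_of_notMem _ _ _ hi]
  · simp

/-- Once the generator occupies the first slot, a second occurrence gives zero, so the other slots
see only `T`-parts. -/
lemma apply_cons_gen (Q : L [⋀^Fin (k + 1)]→ₗ[A] A) (w : Fin k → L) :
    Q (Fin.cons c.gen w) = c.contract k Q (fun i => T.projectionOnto N c.isCompl (w i)) := by
  refine c.apply_projection (Q := Q.curryLeft c.gen) (fun v i hi => ?_) w
  exact Q.map_eq_zero_of_eq (i := 0) (j := i.succ) _ hi.symm (Fin.succ_ne_zero i).symm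

lemma apply_eq_zero_of_contract {Q : L [⋀^Fin (k + 1)]→ₗ[A] A} (hQ : c.contract k Q = 0)
    (v : Fin (k + 1) → L) (i : Fin (k + 1)) (hi : v i = c.gen) : Q v = 0 := by
  rw [← Fin.insertNth_self_removeNth i v, Q.map_insertNth, hi]
  have : Q (Matrix.vecCons c.gen (i.removeNth v)) = 0 := by
    refine (c.apply_cons_gen Q _).trans ?_
    rw [hQ]; rfl
  rw [this, smul_zero]

/-- Uniqueness in the decomposition of a cochain into types `(0, k + 1)` and `(1, k)`. Most
identities between cochains below are checked through these two parts. -/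
lemma eq_zero_of_contract {Q : L [⋀^Fin (k + 1)]→ₗ[A] A} (hQ : c.contract k Q = 0)
    (hQ' : restrictTo T (k + 1) Q = 0) : Q = 0 := by
  ext v
  rw [c.apply_projection (c.apply_eq_zero_of_contract hQ), hQ']
  rfl

lemma contract_eq_zero_of_mem_ofType {Q : L [⋀^Fin (k + 1)]→ₗ[A] A}
    (hQ : Q ∈ ofType T N 0 (k + 1)) : c.contract k Q = 0 := by
  ext t
  refine hQ _ {0} ?_ ?_ (by simp)
  · intro i hi
    rw [Finset.mem_singleton.1 hi]
    exact c.gen_mem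
  · intro i hi
    obtain ⟨j, rfl⟩ := Fin.exists_succ_eq.2 (by simpa using hi)
    exact (t j).2

lemma mem_ofType_zero {Q : L [⋀^Fin (k + 1)]→ₗ[A] A} (hQ : c.contract k Q = 0) :
    Q ∈ ofType T N 0 (k + 1) := by
  intro v S hN hT hS
  obtain ⟨i, hi⟩ := Finset.card_ne_zero.1 hS
  have h := Q.map_update_smul v i (c.coord (v i)) c.gen
  rwa [c.coord_smul_gen _ (hN i hi), Function.update_eq_self,
    c.apply_eq_zero_of_contract hQ _ i (Function.update_self _ _ _), smul_zero] at h

lemma extendAlong_mem (q : T [⋀^Fin k]→ₗ[A] A) : extendAlong c.isCompl q ∈ ofType T N 0 k := by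
  intro v S hN hT hS
  obtain ⟨i, hi⟩ := Finset.card_ne_zero.1 hS
  refine q.map_coord_zero i ?_
  exact (Submodule.projectionOnto_apply_eq_zero_iff _).2 (hN i hi)

lemma apply_of_mem_ofType_zero {Q : L [⋀^Fin k]→ₗ[A] A} (hQ : Q ∈ ofType T N 0 k)
    (v : Fin k → L) : Q v = restrictTo T k Q (fun i => T.projectionOnto N c.isCompl (v i)) := by
  refine c.apply_projection (fun v i hi => ?_) v
  cases k with
  | zero => exact i.elim0
  | succ k => exact c.apply_eq_zero_of_contract (c.contract_eq_zero_of_mem_ofType hQ) v i hi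

/-- Two arguments from `N` are multiples of the same generator, so families with at least two of
them give zero anyway; only the families inside `T` impose a condition. -/
lemma mem_ofType_one (c : LineComplement T N) {Q : L [⋀^Fin k]→ₗ[A] A} (hQ : restrictTo T k Q = 0) :
    Q ∈ ofType T N 1 k := by
  intro v S hN hT hS
  rcases Nat.lt_or_ge S.card 1 with h | h
  · have : S = ∅ := Finset.card_eq_zero.1 (by omega)
    subst this
    exact congrArg (fun q : T [⋀^Fin k]→ₗ[A] A => q fun i => ⟨v i, hT i (by simp)⟩) hQ
  · obtain ⟨i, hi, j, hj, hij⟩ := Finset.one_lt_card.1 (lt_of_le_of_ne h hS.symm)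
    have h1 := Q.map_update_smul v i (c.coord (v i)) c.gen
    have h2 := Q.map_update_smul (Function.update v i c.gen) j (c.coord (v j)) c.gen
    rw [c.coord_smul_gen _ (hN i hi), Function.update_eq_self] at h1
    have e : Function.update (Function.update v i c.gen) j (v j) = Function.update v i c.gen := by
      rw [Function.update_comm hij, Function.update_eq_self]
    have h3 : Q (Function.update (Function.update v i c.gen) j c.gen) = 0 :=
      Q.map_eq_zero_of_eq _ (by simp [Function.update_of_ne hij]) hij
    rw [c.coord_smul_gen _ (hN j hj), e, h3, smul_zero] at h2
    rw [h1, h2, smul_zero]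

/-- The alternating map `coord ∧ q`, whose contraction with the generator is `q`. -/
def wedgeCoord (q : T [⋀^Fin k]→ₗ[A] A) : L [⋀^Fin (k + 1)]→ₗ[A] A :=
  AlternatingMap.alternatizeUncurryFin (c.coord.smulRight (extendAlong c.isCompl q))

lemma wedgeCoord_apply (q : T [⋀^Fin k]→ₗ[A] A) (v : Fin (k + 1) → L) :
    c.wedgeCoord q v = ∑ i : Fin (k + 1),
      (-1) ^ (i : ℕ) • (c.coord (v i) * extendAlong c.isCompl q (i.removeNth v)) := by
  rw [wedgeCoord, AlternatingMap.alternatizeUncurryFin_apply]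
  rfl

lemma contract_wedgeCoord (q : T [⋀^Fin k]→ₗ[A] A) : c.contract k (c.wedgeCoord q) = q := by
  ext t
  rw [contract_apply, wedgeCoord_apply, Fin.sum_univ_succ, Finset.sum_eq_zero, add_zero]
  · rw [Fin.cons_zero, c.coord_gen, one_mul, Fin.val_zero, pow_zero, one_smul]
    change restrictTo T k (extendAlong c.isCompl q) t = _
    rw [restrictTo_extendAlong]
  · intro i _
    rw [Fin.cons_succ, c.coord_of_mem _ (t i).2, zero_mul, smul_zero]

lemma restrictTo_wedgeCoord (q : T [⋀^Fin k]→ₗ[A] A) :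
    restrictTo T (k + 1) (c.wedgeCoord q) = 0 := by
  ext t
  rw [restrictTo_apply, wedgeCoord_apply, Finset.sum_eq_zero]
  · rfl
  · intro i _
    rw [c.coord_of_mem _ (t i).2, zero_mul, smul_zero]

lemma contract_component (θ : L [⋀^Fin (k + 1)]→ₗ[A] A) :
    c.contract k (component c.isCompl 1 (k + 1) θ) = c.contract k θ := by
  ext t
  refine component_apply_of_homogeneous c.isCompl θ (S := {0}) ?_ ?_ (Finset.card_singleton _)
  · intro i hi
    rw [Finset.mem_singleton.1 hi]
    exact c.gen_mem
  · intro i hi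
    obtain ⟨j, rfl⟩ := Fin.exists_succ_eq.2 (by simpa using hi)
    exact (t j).2

end LineComplement

/-! ### Restriction and contraction of differentials -/

section Bracket
variable [Algebra ℝ A] {T N : Submodule A L} (B : AnchoredBracket A L)

/-- The bracket on `T` obtained by projecting the bracket of `L` along the complement `N`. -/
def AnchoredBracket.restrict (h : IsCompl T N) : AnchoredBracket A T where
  anchor := B.anchor ∘ₗ T.subtype
  bracket a b := T.projectionOnto N h (B.bracket a b)
  bracket_add a b c := by rw [Submodule.coe_add, B.bracket_add, map_add]
  bracket_skew a b := by rw [B.bracket_skew, map_neg]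
  bracket_smul a f b := by
    rw [Submodule.coe_smul, B.bracket_smul, map_add, map_smul, map_smul,
      Submodule.projectionOnto_apply_left]
    rfl

variable (c : LineComplement T N) {k : ℕ}

lemma projectionOnto_removeNth_update (t : Fin (k + 1) → T) (i j : Fin (k + 1)) (z : L) (m : Fin k) :
    T.projectionOnto N c.isCompl (j.removeNth (Function.update (fun i => (t i : L)) i z) m) =
      j.removeNth (Function.update t i (T.projectionOnto N c.isCompl z)) m := by
  change T.projectionOnto N c.isCompl (Function.update (fun i => (t i : L)) i z (j.succAbove m)) =
    Function.update t i (T.projectionOnto N c.isCompl z) (j.succAbove m)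
  rcases eq_or_ne (j.succAbove m) i with h | h
  · rw [h, Function.update_self, Function.update_self]
  · rw [Function.update_of_ne h, Function.update_of_ne h, Submodule.projectionOnto_apply_left]

/-- A cochain of type `(0, k)` sees only the `T`-part of a bracket, so `T` need not be closed under
the bracket of `L`. -/
lemma LineComplement.restrictTo_differential {Q : L [⋀^Fin k]→ₗ[A] A}
    (hQ : Q ∈ ofType T N 0 k) : restrictTo T (k + 1) (B.differential k Q) =
      (B.restrict c.isCompl).differential k (restrictTo T k Q) := by
  ext t
  rw [restrictTo_apply, AnchoredBracket.differential_apply, AnchoredBracket.differential_apply,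
    AnchoredBracket.differentialFun, AnchoredBracket.differentialFun]
  refine congrArg₂ (· + ·) rfl ?_
  refine Finset.sum_congr rfl fun j _ => Finset.sum_congr rfl fun i _ => ?_
  rw [c.apply_of_mem_ofType_zero hQ]
  congr 2
  funext m
  exact projectionOnto_removeNth_update c t i j _ m

lemma removeNth_succ_cons {X : Type*} (x : X) (t : Fin (k + 1) → X) (j : Fin (k + 1)) :
    (j.succ).removeNth (Fin.cons x t : Fin (k + 2) → X) = Fin.cons x (j.removeNth t) := by
  funext m
  refine Fin.cases ?_ (fun m => ?_) m
  · simp [Fin.removeNth]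
  · simp [Fin.removeNth]

lemma sum_Iio_succ {G : Type*} [AddCommMonoid G] (f : Fin (k + 2) → G) (j : Fin (k + 1)) :
    ∑ i ∈ Finset.Iio j.succ, f i = f 0 + ∑ i ∈ Finset.Iio j, f i.succ := by
  have h : ∀ {m : ℕ} (g : Fin m → G) (j : Fin m),
      ∑ i ∈ Finset.Iio j, g i = ∑ i, if i < j then g i else 0 := by
    intro m g j
    rw [← Finset.sum_filter]
    congr 1
    ext i
    simp
  rw [h, h, Fin.sum_univ_succ]
  simp [Fin.succ_lt_succ_iff]

/-- The hypotheses remove the terms where the generator differentiates or is bracketed; the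
surviving slots are shifted by one, whence the sign. They hold in two situations: for every `Q` if
the generator is central with zero anchor, and for `Q` of type `(1, k)` if bracketing with the
generator preserves `T`. -/
lemma LineComplement.contract_differential {Q : L [⋀^Fin (k + 1)]→ₗ[A] A}
    (h₁ : ∀ t : Fin (k + 1) → T, B.anchor c.gen (Q fun i => t i) = 0)
    (h₂ : ∀ (z : T) (t : Fin k → T), Q (Fin.cons (B.bracket c.gen z) fun i => t i) = 0) :
    c.contract (k + 1) (B.differential (k + 1) Q) =
      -(B.restrict c.isCompl).differential k (c.contract k Q) := by
  ext t
  rw [contract_apply, AnchoredBracket.differential_apply, AlternatingMap.neg_apply,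
    AnchoredBracket.differential_apply, AnchoredBracket.differentialFun,
    AnchoredBracket.differentialFun, neg_add, Fin.sum_univ_succ (n := k + 1),
    Fin.sum_univ_succ (n := k + 1)]
  have e0 : Finset.Iio (0 : Fin (k + 2)) = ∅ := by ext i; simp
  rw [e0, Finset.sum_empty, zero_add, Fin.removeNth_zero, Fin.tail_cons, Fin.cons_zero, h₁,
    mul_zero, zero_add, ← Finset.sum_neg_distrib, ← Finset.sum_neg_distrib]
  refine congrArg₂ (· + ·) (Finset.sum_congr rfl fun j _ => ?_) (Finset.sum_congr rfl fun j _ => ?_)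
  · rw [removeNth_succ_cons, Fin.cons_succ, Fin.val_succ, pow_succ]
    change _ * B.anchor (t j) (c.contract k Q (j.removeNth t)) =
      -(_ * B.anchor (t j) (c.contract k Q (j.removeNth t)))
    ring
  · rw [sum_Iio_succ, Fin.cons_zero, Fin.cons_succ, Fin.update_cons_zero, removeNth_succ_cons]
    have h3 : Q (Fin.cons (B.bracket c.gen (t j)) (j.removeNth fun i => (t i : L))) = 0 :=
      h₂ (t j) (j.removeNth t)
    rw [h3, mul_zero, zero_add, ← Finset.sum_neg_distrib]
    refine Finset.sum_congr rfl fun i _ => ?_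
    rw [Fin.cons_succ, ← Fin.cons_update, removeNth_succ_cons, c.apply_cons_gen, Fin.val_succ,
      pow_succ]
    have e : (fun m => T.projectionOnto N c.isCompl (j.removeNth
        (Function.update (fun i => (t i : L)) i (B.bracket (t i) (t j))) m)) =
      j.removeNth (Function.update t i ((B.restrict c.isCompl).bracket (t i) (t j))) :=
      funext fun m => projectionOnto_removeNth_update c t i j _ m
    rw [e]
    ring

end Bracket
end LineComplement

/-! ### Maps induced on cohomology and splitting -/

namespace Cohomology
variable {R : Type*} [CommRing R] {C D : ℕ → Type*} [∀ k, AddCommGroup (C k)] [∀ k, Module R (C k)]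
  [∀ k, AddCommGroup (D k)] [∀ k, Module R (D k)]
  {d : ∀ k, C k →ₗ[R] C (k + 1)} {d' : ∀ k, D k →ₗ[R] D (k + 1)} {k m : ℕ}

lemma mk_surjective : Function.Surjective (mk d k) := Submodule.mkQ_surjective _

lemma mk_eq_zero (x : LinearMap.ker (d k)) : mk d k x = 0 ↔ (x : C k) ∈ coboundaries d k :=
  (Submodule.Quotient.mk_eq_zero _).trans Iff.rfl

/-- The map induced on cohomology by a map of cochains in a single degree which preserves cocycles and
coboundaries. -/
def map (f : C k →ₗ[R] D m) (hz : ∀ x, d k x = 0 → d' m (f x) = 0)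
    (hb : ∀ x ∈ coboundaries d k, f x ∈ coboundaries d' m) : Cohomology d k →ₗ[R] Cohomology d' m :=
  Submodule.mapQ _ _ (f.restrict (p := LinearMap.ker (d k)) (q := LinearMap.ker (d' m)) hz)
    fun x hx => hb x hx

lemma map_mk (f : C k →ₗ[R] D m) (hz : ∀ x, d k x = 0 → d' m (f x) = 0)
    (hb : ∀ x ∈ coboundaries d k, f x ∈ coboundaries d' m) (x : LinearMap.ker (d k)) :
    map f hz hb (mk d k x) = mk d' m ⟨f x, hz x x.2⟩ := rfl

/-- The equivalence of cohomology groups induced by an equivalence of cochains in a single degree which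
preserves cocycles and coboundaries. -/
def equiv (e : C k ≃ₗ[R] D m) (hz : ∀ x, d k x = 0 ↔ d' m (e x) = 0)
    (hb : ∀ x, x ∈ coboundaries d k ↔ e x ∈ coboundaries d' m) :
    Cohomology d k ≃ₗ[R] Cohomology d' m :=
  Submodule.Quotient.equiv _ _ (e.ofSubmodules (LinearMap.ker (d k)) (LinearMap.ker (d' m)) <| by
      ext y
      rw [Submodule.mem_map_equiv, LinearMap.mem_ker, LinearMap.mem_ker, hz, e.apply_symm_apply]) <| by
    ext y
    rw [Submodule.mem_map_equiv]
    change e.symm y ∈ coboundaries d k ↔ (y : D m) ∈ coboundaries d' m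
    rw [hb, e.apply_symm_apply]

/-- Isomorphic complexes have isomorphic cohomology. -/
def equivOfComm (e : ∀ k, C k ≃ₗ[R] D k) (he : ∀ k x, d' k (e k x) = e (k + 1) (d k x)) (k : ℕ) :
    Cohomology d k ≃ₗ[R] Cohomology d' k :=
  equiv (e k) (fun x => by rw [he, LinearEquiv.map_eq_zero_iff]) fun x => by
    cases k with
    | zero => exact (LinearEquiv.map_eq_zero_iff (e 0)).symm
    | succ k =>
      constructor
      · rintro ⟨y, rfl⟩
        exact ⟨e k y, he k y⟩
      · rintro ⟨z, hz⟩
        refine ⟨(e k).symm z, (e (k + 1)).injective ?_⟩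
        rw [← he, LinearEquiv.apply_symm_apply, hz]

/-- An isomorphism of complexes of degree `-1` which anticommutes with the differentials, for a complex
with no cochains of degree `0`. -/
def equivOfAnticomm [Subsingleton (C 0)] (e : ∀ k, C (k + 1) ≃ₗ[R] D k)
    (he : ∀ k x, d' k (e k x) = -e (k + 1) (d (k + 1) x)) (k : ℕ) :
    Cohomology d (k + 1) ≃ₗ[R] Cohomology d' k :=
  equiv (e k) (fun x => by rw [he, neg_eq_zero, LinearEquiv.map_eq_zero_iff]) fun x => by
    cases k with
    -- The target has no coboundaries in degree 0, and the source has only zero ones in degree 1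
    -- because `C 0` is trivial.
    | zero =>
      constructor
      · rintro ⟨y, rfl⟩
        rw [Subsingleton.elim y 0, map_zero, map_zero]
        exact Submodule.zero_mem _
      · intro h
        rw [(LinearEquiv.map_eq_zero_iff (e 0)).1 h]
        exact Submodule.zero_mem _
    | succ k =>
      constructor
      · rintro ⟨y, rfl⟩
        exact ⟨e k (-y), by rw [he, map_neg, map_neg, neg_neg]⟩
      · rintro ⟨z, hz⟩
        refine ⟨-(e k).symm z, (e (k + 1)).injective ?_⟩
        rw [map_neg, map_neg, ← he, LinearEquiv.apply_symm_apply, hz]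

end Cohomology

/-- The exact sequence `0 → U ⧸ K → V → W → 0` splits over the field of real numbers. A splitting
over `R` is not available in general, so the equivalence is only real linear. -/
lemma exists_equiv_quotient_prod {R U V W : Type*} [CommRing R] [Algebra ℝ R]
    [AddCommGroup U] [AddCommGroup V] [AddCommGroup W] [Module R U] [Module R V] [Module R W]
    [Module ℝ U] [Module ℝ V] [Module ℝ W] [IsScalarTower ℝ R U] [IsScalarTower ℝ R V]
    [IsScalarTower ℝ R W] (f : U →ₗ[R] V) (g : V →ₗ[R] W) (K : Submodule R U)
    (hK : LinearMap.ker f = K) (hfg : LinearMap.range f = LinearMap.ker g)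
    (hg : Function.Surjective g) : Nonempty (V ≃ₗ[ℝ] (U ⧸ K) × W) := by
  subst hK
  have hf : Function.Injective ((LinearMap.ker f).liftQ f le_rfl) :=
    LinearMap.ker_eq_bot.1 (Submodule.ker_liftQ_eq_bot _ _ _ le_rfl)
  let f' : (U ⧸ LinearMap.ker f) →ₗ[ℝ] V := ((LinearMap.ker f).liftQ f le_rfl).restrictScalars ℝ
  have hex : Function.Exact f' (g.restrictScalars ℝ) := by
    intro v
    have h : v ∈ LinearMap.range ((LinearMap.ker f).liftQ f le_rfl) ↔ v ∈ LinearMap.ker g := by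
      rw [Submodule.range_liftQ, hfg]
    exact (LinearMap.mem_ker.symm.trans h.symm)
  obtain ⟨s, hs⟩ := (g.restrictScalars ℝ).exists_rightInverse_of_surjective
    (LinearMap.range_eq_top.2 hg)
  exact ⟨(hex.splitSurjectiveEquiv hf ⟨s, hs⟩).1⟩

/-! ### Leafwise and total cohomology relative to a rank-one complement -/

section LeafCohomology
variable {A L L' : Type*} [CommRing A] [Algebra ℝ A] [AddCommGroup L] [Module A L]
  [AddCommGroup L'] [Module A L'] {T N : Submodule A L}

lemma AnchoredBracket.differential_compLinearMap (B : AnchoredBracket A L)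
    (B' : AnchoredBracket A L') (e : L →ₗ[A] L') (ha : ∀ a, B'.anchor (e a) = B.anchor a)
    (hb : ∀ a b, e (B.bracket a b) = B'.bracket (e a) (e b)) {k : ℕ} (Q : L' [⋀^Fin k]→ₗ[A] A) :
    B.differential k (Q.compLinearMap e) = (B'.differential k Q).compLinearMap e := by
  ext v
  change B.differentialFun _ v = B'.differentialFun Q fun i => e (v i)
  rw [AnchoredBracket.differentialFun, AnchoredBracket.differentialFun]
  refine congrArg₂ (· + ·) (Finset.sum_congr rfl fun j _ => ?_)
    (Finset.sum_congr rfl fun j _ => Finset.sum_congr rfl fun i _ => ?_)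
  · rw [ha]
    rfl
  · rw [← hb]
    change _ * Q _ = _
    congr 2
    funext m
    exact congrFun (Function.comp_update e v i (B.bracket (v i) (v j))) (j.succAbove m)

/-- Isomorphic anchored brackets have isomorphic cohomology. -/
def totalCohomologyEquiv (B : AnchoredBracket A L) (B' : AnchoredBracket A L') (R : Subalgebra ℝ A)
    (hR : ∀ f ∈ R, ∀ a, B.anchor a f = 0) (hR' : ∀ f ∈ R, ∀ a, B'.anchor a f = 0) (e : L ≃ₗ[A] L')
    (ha : ∀ a, B'.anchor (e a) = B.anchor a)
    (hb : ∀ a b, e (B.bracket a b) = B'.bracket (e a) (e b)) (k : ℕ) :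
    TotalCohomology B' R hR' k ≃ₗ[R] TotalCohomology B R hR k :=
  Cohomology.equivOfComm
    (fun k =>
      { toFun := fun Q : L' [⋀^Fin k]→ₗ[A] A => Q.compLinearMap (e : L →ₗ[A] L')
        map_add' := fun _ _ => rfl
        map_smul' := fun _ _ => rfl
        invFun := fun Q => Q.compLinearMap (e.symm : L' →ₗ[A] L)
        left_inv := fun Q => by ext v; simp
        right_inv := fun Q => by ext v; simp })
    (fun _ Q => B.differential_compLinearMap B' e ha hb Q) k

variable (B : AnchoredBracket A L) (c : LineComplement T N) (R : Subalgebra ℝ A)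
  (hR : ∀ f ∈ R, ∀ a ∈ T, B.anchor a f = 0) (hR' : ∀ f ∈ R, ∀ a, B.anchor a f = 0)

namespace LineComplement

/-- Cochains of type `(0, k)` are the alternating maps on `T`. -/
def ofTypeZeroEquiv (k : ℕ) : ofType T N 0 k ≃ₗ[R] (T [⋀^Fin k]→ₗ[A] A) where
  toFun Q := restrictTo T k Q
  map_add' _ _ := rfl
  map_smul' _ _ := rfl
  invFun q := ⟨extendAlong c.isCompl q, c.extendAlong_mem q⟩
  left_inv Q := by
    ext v
    exact (c.apply_of_mem_ofType_zero Q.2 v).symm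
  right_inv q := restrictTo_extendAlong c.isCompl q

/-- Cochains of type `(1, k)` are the alternating maps on `T` in one argument less. -/
def ofTypeOneEquiv (k : ℕ) : ofType T N 1 (k + 1) ≃ₗ[R] (T [⋀^Fin k]→ₗ[A] A) where
  toFun Q := c.contract k Q
  map_add' _ _ := rfl
  map_smul' _ _ := rfl
  invFun q := ⟨c.wedgeCoord q, c.mem_ofType_one (c.restrictTo_wedgeCoord q)⟩
  left_inv Q := by
    refine Subtype.ext (sub_eq_zero.1 (c.eq_zero_of_contract ?_ ?_))
    · rw [map_sub, c.contract_wedgeCoord, sub_self]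
    · rw [map_sub, c.restrictTo_wedgeCoord, restrictTo_eq_zero_of_mem_ofType Q.2, sub_zero]
  right_inv q := c.contract_wedgeCoord q

/-- The leafwise cohomology of type `(0, •)` is the cohomology of the projected bracket. -/
def leafCohomologyZeroEquiv (k : ℕ) : LeafCohomology B c.isCompl R hR 0 k ≃ₗ[R]
    TotalCohomology (B.restrict c.isCompl) R (fun f hf a => hR f hf a a.2) k :=
  Cohomology.equivOfComm (C := fun j => ofType T N 0 j) (fun k => c.ofTypeZeroEquiv R k)
    (fun _ Q => ((restrictTo_component c.isCompl _).trans
      (c.restrictTo_differential B Q.2)).symm) k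

/-- The leafwise cohomology of type `(1, •)` is the cohomology of the projected bracket if bracketing
with the generator of the complement preserves `T`. -/
def leafCohomologyOneEquiv (hT : ∀ t ∈ T, B.bracket c.gen t ∈ T) (k : ℕ) :
    LeafCohomology B c.isCompl R hR 1 (k + 1) ≃ₗ[R]
      TotalCohomology (B.restrict c.isCompl) R (fun f hf a => hR f hf a a.2) k :=
  -- A 0-cochain has no slot for a transversal argument, so the complex of type `(1, •)` starts in
  -- total degree 1; this accounts for the shift from `k + 1` to `k`.
  have : Subsingleton (ofType T N 1 0) := ⟨fun Q S => by
    have h : ∀ Q : ofType T N 1 0, Q = 0 := fun Q => by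
      ext v
      exact apply_eq_zero_of_mem_ofType Q.2 v fun i => i.elim0
    rw [h Q, h S]⟩
  Cohomology.equivOfAnticomm (C := fun j => ofType T N 1 j) (fun k => c.ofTypeOneEquiv R k)
    (fun k Q => by
      change (B.restrict c.isCompl).differential k (c.contract k Q) =
        -c.contract (k + 1) (component c.isCompl 1 (k + 2) (B.differential (k + 1) Q))
      rw [c.contract_component, c.contract_differential B, neg_neg]
      · intro t
        rw [apply_eq_zero_of_mem_ofType Q.2 _ fun i => (t i).2, map_zero]
      · intro z t
        refine apply_eq_zero_of_mem_ofType Q.2 _ fun i => ?_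
        refine Fin.cases ?_ (fun i => ?_) i
        · exact hT z z.2
        · exact (t i).2) k

lemma contract_differential_of_central (hanchor : B.anchor c.gen = 0)
    (hbracket : ∀ t ∈ T, B.bracket c.gen t = 0)
    {k : ℕ} (Q : L [⋀^Fin (k + 1)]→ₗ[A] A) :
    c.contract (k + 1) (B.differential (k + 1) Q) =
      -(B.restrict c.isCompl).differential k (c.contract k Q) := by
  refine c.contract_differential B (fun t => ?_) fun z t => ?_
  · rw [hanchor]; rfl
  · rw [hbracket z z.2]
    exact Q.map_coord_zero 0 rfl

lemma _root_.AlternatingMap.eq_zero_of_forall_three_eq_zero (hthree : ∀ q : T [⋀^Fin 3]→ₗ[A] A, q = 0)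
    (q : T [⋀^Fin 4]→ₗ[A] A) : q = 0 := by
  ext v
  have h := congrArg (fun r : T [⋀^Fin 3]→ₗ[A] A => r (Fin.tail v)) (hthree (q.curryLeft (v 0)))
  change q (Fin.cons (v 0) (Fin.tail v)) = 0 at h
  rwa [Fin.cons_self_tail] at h

/-- If the generator of the complement is central and all 3-cochains on `T` vanish, then the third
cohomology is the second cohomology of the projected bracket. -/
def totalCohomologyThreeEquiv (hanchor : B.anchor c.gen = 0)
    (hbracket : ∀ t ∈ T, B.bracket c.gen t = 0)
    (hthree : ∀ q : T [⋀^Fin 3]→ₗ[A] A, q = 0) : TotalCohomology B R hR' 3 ≃ₗ[R]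
    TotalCohomology (B.restrict c.isCompl) R (fun f hf a => hR' f hf a) 2 :=
  Cohomology.equiv (C := fun j => L [⋀^Fin j]→ₗ[A] A) (D := fun j => T [⋀^Fin j]→ₗ[A] A)
    { toFun := fun Q => c.contract 2 Q
      map_add' := fun _ _ => rfl
      map_smul' := fun _ _ => rfl
      invFun := fun q => c.wedgeCoord q
      left_inv := fun Q => by
        -- The restriction of a 3-cochain to `T` vanishes, so the contraction determines it.
        refine sub_eq_zero.1 (c.eq_zero_of_contract ?_ (hthree _))
        rw [map_sub, c.contract_wedgeCoord, sub_self]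
      right_inv := fun q => c.contract_wedgeCoord q }
    -- Every cochain is a cocycle on both sides: a 4-cochain on `L` has its contraction in degree 3
    -- on `T` and its restriction in degree 4, both zero, and a 3-cochain on `T` is zero.
    (fun Q => iff_of_true
      (c.eq_zero_of_contract (hthree _) (AlternatingMap.eq_zero_of_forall_three_eq_zero hthree _)) (hthree _))
    (fun Q => by
      constructor
      · rintro ⟨V, rfl⟩
        refine ⟨c.contract 1 (-V), ?_⟩
        change (B.restrict c.isCompl).differential 1 _ = c.contract 2 (B.differential 2 V)
        rw [c.contract_differential_of_central B hanchor hbracket, map_neg, map_neg]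
      · rintro ⟨q, hq⟩
        change (B.restrict c.isCompl).differential 1 q = c.contract 2 Q at hq
        refine ⟨c.wedgeCoord (-q), sub_eq_zero.1 (c.eq_zero_of_contract ?_ (hthree _))⟩
        change c.contract 2 (B.differential 2 _ - Q) = 0
        rw [map_sub, c.contract_differential_of_central B hanchor hbracket, c.contract_wedgeCoord,
          map_neg, neg_neg, hq, sub_self])

/-- The contraction of the differential is minus the differential of the contraction, which is zero
(in degree 0 the zero anchor suffices). On type `(0, •)` the leafwise differential is thus the full
one, and the inclusion into all cochains is compatible with the differentials. -/
lemma differential_mem_ofType_zero (c : LineComplement T N) (hanchor : B.anchor c.gen = 0)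
    (hbracket : ∀ t ∈ T, B.bracket c.gen t = 0)
    {k : ℕ} {Q : L [⋀^Fin k]→ₗ[A] A} (hQ : Q ∈ ofType T N 0 k) :
    B.differential k Q ∈ ofType T N 0 (k + 1) := by
  refine c.mem_ofType_zero ?_
  cases k with
  | zero =>
    ext t
    rw [contract_apply, AnchoredBracket.differential_apply, AnchoredBracket.differentialFun]
    have e0 : Finset.Iio (0 : Fin 1) = ∅ := by ext i; simp
    simp [hanchor, e0]
  | succ k =>
    rw [c.contract_differential_of_central B hanchor hbracket,
      c.contract_eq_zero_of_mem_ofType hQ, map_zero, neg_zero]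

lemma component_of_mem_ofType_zero {k : ℕ} {Q : L [⋀^Fin k]→ₗ[A] A} (hQ : Q ∈ ofType T N 0 k) :
    component c.isCompl 0 k Q = Q := by
  ext v
  rw [c.apply_of_mem_ofType_zero hQ, c.apply_of_mem_ofType_zero (component_mem _ _ _ _),
    restrictTo_component]

lemma coe_leafDifferential_zero (hanchor : B.anchor c.gen = 0)
    (hbracket : ∀ t ∈ T, B.bracket c.gen t = 0)
    {k : ℕ} (Q : ofType T N 0 k) :
    (leafDifferential B c.isCompl R hR 0 k Q : L [⋀^Fin (k + 1)]→ₗ[A] A) = B.differential k Q :=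
  c.component_of_mem_ofType_zero (c.differential_mem_ofType_zero B hanchor hbracket Q.2)

/-- If the generator of the complement is central and all 3-cochains on `T` vanish, then the second
cohomology is the sum of the leafwise one, modulo the leafwise differentials of transversal cochains,
and the first cohomology of the projected bracket. -/
lemma exists_totalCohomologyTwoEquiv (hanchor : B.anchor c.gen = 0)
    (hbracket : ∀ t ∈ T, B.bracket c.gen t = 0)
    (hthree : ∀ q : T [⋀^Fin 3]→ₗ[A] A, q = 0) : Nonempty (TotalCohomology B R hR' 2 ≃ₗ[ℝ]
    (LeafCohomology B c.isCompl R hR 0 2 ⧸ transverseClasses B c.isCompl R hR hR' 1) ×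
      TotalCohomology (B.restrict c.isCompl) R (fun f hf a => hR' f hf a) 1) := by
  have hleaf := fun (k : ℕ) (Q : ofType T N 0 k) =>
    c.coe_leafDifferential_zero B R hR hanchor hbracket Q
  have hcontr := fun (k : ℕ) (Q : L [⋀^Fin (k + 1)]→ₗ[A] A) =>
    c.contract_differential_of_central B hanchor hbracket Q
  let incl : ofType T N 0 2 →ₗ[R] (L [⋀^Fin 2]→ₗ[A] A) :=
    { toFun := Subtype.val, map_add' := fun _ _ => rfl, map_smul' := fun _ _ => rfl }
  let contr : (L [⋀^Fin 2]→ₗ[A] A) →ₗ[R] (T [⋀^Fin 1]→ₗ[A] A) :=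
    { toFun := c.contract 1, map_add' := fun _ _ => rfl, map_smul' := fun _ _ => rfl }
  let f : LeafCohomology B c.isCompl R hR 0 2 →ₗ[R] TotalCohomology B R hR' 2 :=
    Cohomology.map (C := fun j => ofType T N 0 j) (D := fun j => L [⋀^Fin j]→ₗ[A] A) incl
      (fun Q hQ => (hleaf 2 Q).symm.trans (congrArg Subtype.val hQ))
      (by
        rintro _ ⟨Q, rfl⟩
        exact ⟨Q, (hleaf 1 Q).symm⟩)
  let g : TotalCohomology B R hR' 2 →ₗ[R]
      TotalCohomology (B.restrict c.isCompl) R (fun f hf a => hR' f hf a) 1 :=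
    Cohomology.map (C := fun j => L [⋀^Fin j]→ₗ[A] A) (D := fun j => T [⋀^Fin j]→ₗ[A] A) contr
      (fun Q hQ => by
        change (B.restrict c.isCompl).differential 1 (c.contract 1 Q) = 0
        rw [← neg_eq_zero, ← hcontr, show B.differential 2 Q = 0 from hQ, map_zero])
      (by
        rintro _ ⟨V, rfl⟩
        refine ⟨c.contract 0 (-V), ?_⟩
        change (B.restrict c.isCompl).differential 0 _ = c.contract 1 (B.differential 1 V)
        rw [hcontr, map_neg, map_neg])
  refine exists_equiv_quotient_prod f g _ ?_ ?_ ?_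
  · ext q
    obtain ⟨Q, rfl⟩ := Cohomology.mk_surjective q
    rw [LinearMap.mem_ker]
    refine (Cohomology.mk_eq_zero _).trans ?_
    constructor
    · rintro ⟨V, hV⟩
      change B.differential 1 V = (Q : ofType T N 0 2) at hV
      -- Subtracting the differential of the tangential part `V₀` does not change the leafwise class
      -- of `Q` and replaces the primitive `V` by the transversal cochain `V - V₀`.
      let V₀ : ofType T N 0 1 := ⟨extendAlong c.isCompl (restrictTo T 1 V), c.extendAlong_mem _⟩
      let Q₁ : ofType T N 0 2 := Q - leafDifferential B c.isCompl R hR 0 1 V₀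
      have hQ₁ : Q₁ ∈ transverseImage B R hR' 1 := by
        refine ⟨V - V₀, c.mem_ofType_one ?_, ?_⟩
        · rw [map_sub, restrictTo_extendAlong, sub_self]
        · rw [map_sub, hV]
          exact congrArg _ (hleaf 1 V₀).symm
      -- A cochain of type `(0, 3)` is determined by its restriction to `T`, which vanishes.
      have hz : leafDifferential B c.isCompl R hR 0 2 Q₁ = 0 := by
        obtain ⟨W, -, hW⟩ := hQ₁
        have h1 : leafDifferential B c.isCompl R hR 0 2 Q = 0 := Q.2
        refine (map_sub _ _ _).trans ?_
        rw [h1, zero_sub, neg_eq_zero]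
        refine (c.ofTypeZeroEquiv R 3).injective ?_
        exact (hthree _).trans (hthree _).symm
      refine ⟨⟨Q₁, hz⟩, hQ₁, ?_⟩
      rw [← sub_eq_zero, ← map_sub]
      refine (Cohomology.mk_eq_zero _).2 ⟨-V₀, ?_⟩
      rw [map_neg]
      change _ = Q₁ - (Q : ofType T N 0 2)
      exact (sub_sub_cancel_left _ _).symm
    · rintro ⟨Q₁, ⟨V, -, hV⟩, hQ⟩
      rw [← sub_eq_zero, ← map_sub] at hQ
      obtain ⟨W, hW⟩ := (Cohomology.mk_eq_zero _).1 hQ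
      refine ⟨V - W, ?_⟩
      change B.differential 1 (V - W) = (Q : ofType T N 0 2)
      rw [map_sub, hV, ← hleaf, hW]
      exact sub_sub_cancel _ _
  · ext q
    obtain ⟨Q, rfl⟩ := Cohomology.mk_surjective q
    rw [LinearMap.mem_ker]
    constructor
    · rintro ⟨s, hs⟩
      obtain ⟨S, rfl⟩ := Cohomology.mk_surjective s
      rw [← hs]
      refine (Cohomology.mk_eq_zero _).2 ?_
      have h0 : c.contract 1 ((S : ofType T N 0 2) : L [⋀^Fin 2]→ₗ[A] A) = 0 :=
        c.contract_eq_zero_of_mem_ofType (S : ofType T N 0 2).2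
      change c.contract 1 ((S : ofType T N 0 2) : L [⋀^Fin 2]→ₗ[A] A) ∈ _
      rw [h0]
      exact Submodule.zero_mem _
    · intro h
      obtain ⟨r, hr⟩ := (Cohomology.mk_eq_zero _).1 h
      change (B.restrict c.isCompl).differential 0 r = c.contract 1 Q at hr
      have hdQ : B.differential 2 Q = 0 := Q.2
      -- A square-zero differential is not part of `AnchoredBracket`. Here the contraction of the
      -- double differential is the differential on `T` of `c.contract 1 Q`, which vanishes since
      -- `Q` is a cocycle; the restriction to `T` is a 3-cochain.
      have hdd : B.differential 2 (B.differential 1 (c.wedgeCoord r)) = 0 := by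
        refine c.eq_zero_of_contract ?_ (hthree _)
        rw [hcontr, hcontr, c.contract_wedgeCoord, hr, map_neg, neg_neg, ← neg_eq_zero, ← hcontr,
          hdQ, map_zero]
      -- The contraction of the added coboundary is minus the differential of `r`, which cancels
      -- that of `Q` and leaves a cocycle of type `(0, 2)` in the same class.
      let S : ofType T N 0 2 := ⟨Q + B.differential 1 (c.wedgeCoord r), c.mem_ofType_zero (by
        rw [map_add, hcontr, c.contract_wedgeCoord, hr, add_neg_cancel])⟩
      have hS : leafDifferential B c.isCompl R hR 0 2 S = 0 := by
        refine Subtype.ext ((hleaf 2 S).trans ?_)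
        change B.differential 2 (Q + B.differential 1 (c.wedgeCoord r)) = 0
        rw [map_add, hdQ, hdd, add_zero]
      refine ⟨Cohomology.mk (C := fun j => ofType T N 0 j) _ 2 ⟨S, hS⟩, ?_⟩
      refine sub_eq_zero.1 ?_
      change Cohomology.mk (C := fun j => L [⋀^Fin j]→ₗ[A] A) (totalDifferential B R hR') 2
        ⟨S, _⟩ - Cohomology.mk (C := fun j => L [⋀^Fin j]→ₗ[A] A) _ 2 Q = 0
      rw [← map_sub]
      refine (Cohomology.mk_eq_zero _).2 ⟨c.wedgeCoord r, ?_⟩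
      exact (add_sub_cancel_left _ _).symm
  · intro q
    obtain ⟨r, rfl⟩ := Cohomology.mk_surjective q
    have hr : (B.restrict c.isCompl).differential 1 r = 0 := r.2
    -- The lift of `r` is `coord ∧ r`. Its differential contracts to minus the differential of `r`,
    -- which is zero, and restricts to a 3-cochain on `T`; so there is no obstruction in degree 3.
    refine ⟨Cohomology.mk (C := fun j => L [⋀^Fin j]→ₗ[A] A) _ 2 ⟨c.wedgeCoord r, ?_⟩, ?_⟩
    · refine c.eq_zero_of_contract ?_ (hthree _)
      change c.contract 2 (B.differential 2 _) = 0
      rw [hcontr, c.contract_wedgeCoord, hr, neg_zero]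
    · refine (Cohomology.map_mk (C := fun j => L [⋀^Fin j]→ₗ[A] A)
        (D := fun j => T [⋀^Fin j]→ₗ[A] A) contr _ _ _).trans ?_
      congr 1
      exact Subtype.ext (c.contract_wedgeCoord _)

end LineComplement
end LeafCohomology

/-! ### Formulas in low degree and the vanishing of 3-cochains -/

section LowDegree
variable {A L : Type*} [CommRing A] [AddCommGroup L] [Module A L]

lemma AnchoredBracket.differentialFun_one [Algebra ℝ A] (B : AnchoredBracket A L)
    (Q : L [⋀^Fin 1]→ₗ[A] A) (x y : L) : B.differentialFun Q ![x, y] =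
      B.anchor x (Q fun _ => y) - B.anchor y (Q fun _ => x) - Q fun _ => B.bracket x y := by
  have e0 : Finset.Iio (0 : Fin 2) = ∅ := rfl
  have e1 : Finset.Iio (1 : Fin 2) = {0} := rfl
  have h0 : ∀ v : Fin 2 → L, Fin.removeNth (0 : Fin 2) v = fun _ => v 1 := fun v => by
    funext i; fin_cases i; rfl
  have h1 : ∀ v : Fin 2 → L, Fin.removeNth (1 : Fin 2) v = fun _ => v 0 := fun v => by
    funext i; fin_cases i; rfl
  rw [differentialFun, Fin.sum_univ_two, Fin.sum_univ_two, e0, e1, Finset.sum_empty,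
    Finset.sum_singleton, h0, h1, h1, Function.update_self]
  simp
  ring

lemma AnchoredBracket.differentialFun_two [Algebra ℝ A] (B : AnchoredBracket A L)
    (Q : L [⋀^Fin 2]→ₗ[A] A) (x y z : L) : B.differentialFun Q ![x, y, z] =
      B.anchor x (Q ![y, z]) - B.anchor y (Q ![x, z]) + B.anchor z (Q ![x, y]) -
        Q ![B.bracket x y, z] + Q ![B.bracket x z, y] + Q ![x, B.bracket y z] := by
  have e0 : Finset.Iio (0 : Fin 3) = ∅ := rfl
  have e1 : Finset.Iio (1 : Fin 3) = {0} := rfl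
  have e2 : Finset.Iio (2 : Fin 3) = {0, 1} := rfl
  have h0 : ∀ v : Fin 3 → L, Fin.removeNth (0 : Fin 3) v = ![v 1, v 2] := fun v => by
    funext i; fin_cases i <;> rfl
  have h1 : ∀ v : Fin 3 → L, Fin.removeNth (1 : Fin 3) v = ![v 0, v 2] := fun v => by
    funext i; fin_cases i <;> rfl
  have h2 : ∀ v : Fin 3 → L, Fin.removeNth (2 : Fin 3) v = ![v 0, v 1] := fun v => by
    funext i; fin_cases i <;> rfl
  rw [differentialFun, Fin.sum_univ_three, Fin.sum_univ_three, e0, e1, e2, Finset.sum_empty,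
    Finset.sum_singleton, Finset.sum_pair (by decide)]
  simp only [h0, h1, h2]
  simp
  ring

/-- After multiplication by `l`, each of the three arguments becomes a combination of `g₁` and `g₂`,
and every term of the expansion repeats one of them. This localised form of rank two serves for a
module with no global frame, with `l` invertible near a given point. -/
lemma pow_three_mul_alternatingMap {l : A} {s t : L → A} {g₁ g₂ : L}
    (h : ∀ a, l • a = t a • g₁ - s a • g₂) (q : L [⋀^Fin 3]→ₗ[A] A) (v : Fin 3 → L) :
    l ^ 3 * q v = 0 := by
  have hU : ∀ (v : Fin 3 → L) (i : Fin 3), l * q v =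
      t (v i) * q (Function.update v i g₁) - s (v i) * q (Function.update v i g₂) := by
    intro v i
    have h1 := q.map_update_smul v i l (v i)
    rw [Function.update_eq_self, h, q.map_update_sub, q.map_update_smul, q.map_update_smul] at h1
    exact h1.symm
  have hz : ∀ (v : Fin 3 → L) (i j : Fin 3), i ≠ j → v i = v j → q v = 0 := fun v i j hij hv =>
    q.map_eq_zero_of_eq v hv hij
  have h12 : ∀ (v : Fin 3 → L) (i j k : Fin 3), i ≠ k → j ≠ k → v i = g₁ → v j = g₂ →
      l * q v = 0 := by
    intro v i j k hik hjk hi hj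
    rw [hU v k, hz _ i k hik, hz _ j k hjk]
    · ring
    · rw [Function.update_of_ne hjk, Function.update_self, hj]
    · rw [Function.update_of_ne hik, Function.update_self, hi]
  have hg₁ : ∀ v : Fin 3 → L, v 0 = g₁ → l ^ 2 * q v = 0 := by
    intro v h0
    rw [pow_two, mul_assoc, hU v 1, hz (Function.update v 1 g₁) 0 1 (by decide), mul_sub,
      mul_left_comm l (s _), h12 _ 0 1 2 (by decide) (by decide)]
    · ring
    · simp [h0]
    · simp
    · simp [h0]
  have hg₂ : ∀ v : Fin 3 → L, v 0 = g₂ → l ^ 2 * q v = 0 := by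
    intro v h0
    rw [pow_two, mul_assoc, hU v 1, hz (Function.update v 1 g₂) 0 1 (by decide), mul_sub,
      mul_left_comm l (t _), h12 _ 1 0 2 (by decide) (by decide)]
    · ring
    · simp
    · simp [h0]
    · simp [h0]
  calc l ^ 3 * q v = l ^ 2 * (l * q v) := by ring
    _ = t (v 0) * (l ^ 2 * q (Function.update v 0 g₁)) -
        s (v 0) * (l ^ 2 * q (Function.update v 0 g₂)) := by rw [hU v 0]; ring
    _ = 0 := by rw [hg₁ _ (by simp), hg₂ _ (by simp)]; ring

/-- The alternating map in two arguments given by an alternating bilinear form. -/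
def alternatingOfBilin (w : L →ₗ[A] L →ₗ[A] A) (hw : ∀ x, w x x = 0) : L [⋀^Fin 2]→ₗ[A] A where
  toFun v := w (v 0) (v 1)
  map_update_add' := by
    intro inst v i x y
    cases Subsingleton.elim inst (instDecidableEqFin _)
    fin_cases i <;> simp
  map_update_smul' := by
    intro inst v i f x
    cases Subsingleton.elim inst (instDecidableEqFin _)
    fin_cases i <;> simp
  map_eq_zero_of_eq' := by
    intro v i j h hij
    fin_cases i <;> fin_cases j <;> simp_all

end LowDegree

/-! ### The algebra of a closed defining form and its unit field -/

namespace PoissonStructure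
variable {E : Type*} [NormedAddCommGroup E] [NormedSpace ℝ E] [FiniteDimensional ℝ E]
  {M : Type*} [TopologicalSpace M] [ChartedSpace E M] [IsManifold 𝓘(ℝ, E) ∞ M] [T2Space M]
  (P : PoissonStructure E M)

/-- A vector field, transversal to the foliation defined by a closed 1-form `form`, on which the form
is `1`. -/
structure TransversalDistribution.UnitField {P : PoissonStructure E M}
    (ν : P.TransversalDistribution) where
  form : OneForm E M
  form_apply_eq_zero : ∀ (X : SmoothVectorField E M) (x : M), form X x = 0 ↔ X x ∈ P.leafTangent x
  closed : ∀ X Y, lieDerivFunction X (form Y) - lieDerivFunction Y (form X) -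
    form (lieBracket X Y) = 0
  field : SmoothVectorField E M
  field_mem : field ∈ ν.fields
  form_field : form field = 1

namespace TransversalDistribution.UnitField
variable {P} {ν : P.TransversalDistribution} (u : ν.UnitField)

lemma mem_tangentialFields {X : SmoothVectorField E M} :
    X ∈ P.tangentialFields ↔ u.form X = 0 := by
  constructor
  · intro h
    ext x
    exact (u.form_apply_eq_zero X x).2 (h x)
  · intro h x
    rw [← u.form_apply_eq_zero, h]
    rfl

/-- The decomposition of the vector fields into tangential and transversal ones. -/
def fieldComplement : LineComplement P.tangentialFields ν.fields where
  isCompl := ν.isCompl_fields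
  gen := u.field
  gen_mem := u.field_mem
  coord := u.form
  coord_of_mem _ h := u.mem_tangentialFields.1 h
  coord_gen := u.form_field
  coord_smul_gen v hv := by
    rw [ν.oneForm_smul_comm u.form_apply_eq_zero hv u.field_mem, u.form_field, one_smul]

lemma form_sharp (α : OneForm E M) : u.form (P.sharp α) = 0 :=
  u.mem_tangentialFields.1 (P.sharp_mem_tangentialFields α)

lemma sharp_form : P.sharp u.form = 0 :=
  vectorField_eq_of_oneForm fun α => by rw [P.oneForm_sharp, u.form_sharp, neg_zero, map_zero]

/-- The decomposition of the 1-forms into tangential and transversal ones. -/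
def formComplement :
    LineComplement ν.fields.dualAnnihilator P.tangentialFields.dualAnnihilator where
  isCompl := ν.isCompl_annihilators
  gen := u.form
  gen_mem := (Submodule.mem_dualAnnihilator _).2 fun _ h => u.mem_tangentialFields.1 h
  coord := LinearMap.applyₗ u.field
  coord_of_mem α hα := (Submodule.mem_dualAnnihilator α).1 hα _ u.field_mem
  coord_gen := u.form_field
  coord_smul_gen α hα := by
    ext1 X
    have h := congrArg α (u.fieldComplement.eq_projection_add X)
    rw [map_add, map_smul, (Submodule.mem_dualAnnihilator α).1 hα _
      (Submodule.projection_apply_mem _ _), zero_add] at h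
    rw [h]
    exact mul_comm _ _

/-- Only `-L_{α^#}` of the form survives since its `#` is zero, and by Cartan's formula this
vanishes: the form is closed and kills `α^#`. -/
lemma koszulBracket_form (α : OneForm E M) : P.koszulBracket u.form α = 0 := by
  ext1 W
  have h0 : lieBracket (0 : SmoothVectorField E M) W = 0 := by
    have := (tangentAlgebroid E M).smul_bracket 0 0 W
    rwa [zero_smul, zero_smul, smul_zero, sub_zero] at this
  have hd : ∀ (X : SmoothVectorField E M), lieDerivFunction X 0 = 0 := fun X =>
    map_zero (toDerivation X)
  have h1 : ∀ f : SmoothFunction E M, lieDerivFunction (0 : SmoothVectorField E M) f = 0 := fun f => by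
    rw [← anchor_apply, map_zero]; rfl
  have h2 := u.closed (P.sharp α) W
  rw [u.form_sharp, hd, sub_zero] at h2
  simp only [koszulBracket, bivector, LinearMap.sub_apply, lieDerivOneForm_apply,
    differentialFunction_apply, u.sharp_form, h0, h1, map_zero, hd, h2, sub_zero]
  rfl

/-- Closedness gives `β([Y, X]) = Y(β(X)) - X(β(Y)) = Y(0) - X(1) = 0`. The normalisation `β(Y) = 1`
is what makes the second term vanish. -/
lemma lieBracket_field_mem {X : SmoothVectorField E M} (hX : X ∈ P.tangentialFields) :
    lieBracket u.field X ∈ P.tangentialFields := by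
  have h := u.closed u.field X
  have h0 : lieDerivFunction u.field (0 : SmoothFunction E M) = 0 := map_zero (toDerivation u.field)
  have h1 : lieDerivFunction X (1 : SmoothFunction E M) = 0 := (toDerivation X).map_one_eq_zero
  rw [u.mem_tangentialFields.1 hX, u.form_field, h0, h1, sub_zero, zero_sub, neg_eq_zero] at h
  exact u.mem_tangentialFields.2 h

lemma lieBracket_mem (u : ν.UnitField) {X Y : SmoothVectorField E M} (hX : X ∈ P.tangentialFields)
    (hY : Y ∈ P.tangentialFields) : lieBracket X Y ∈ P.tangentialFields := by
  have h := u.closed X Y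
  have h0 : ∀ X : SmoothVectorField E M, lieDerivFunction X 0 = 0 := fun X =>
    map_zero (toDerivation X)
  rw [u.mem_tangentialFields.1 hX, u.mem_tangentialFields.1 hY, h0, h0, sub_zero, zero_sub,
    neg_eq_zero] at h
  exact u.mem_tangentialFields.2 h

/-- The symplectic form of the leaves identifies tangential 1-forms with tangential vector fields. -/
def sharpEquiv (hP : P.IsRegularOfRank 2) :
    ν.fields.dualAnnihilator ≃ₗ[SmoothFunction E M] P.tangentialFields :=
  LinearEquiv.ofBijective ((P.sharp ∘ₗ ν.fields.dualAnnihilator.subtype).codRestrict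
    P.tangentialFields fun α => P.sharp_mem_tangentialFields α) <| by
  constructor
  · rw [injective_iff_map_eq_zero]
    rintro ⟨α, hα⟩ h
    have h0 : P.sharp α = 0 := congrArg Subtype.val h
    refine Subtype.ext ?_
    change α = 0
    ext1 X
    rw [u.fieldComplement.eq_projection_add X]
    -- By skew-symmetry a form with zero `#` kills every `γ^#`, hence all tangential fields; it
    -- kills `u.field` because it annihilates `ν`.
    obtain ⟨γ, -, hγ⟩ := ν.exists_sharp_eq hP
      (Submodule.projection_apply_mem u.fieldComplement.isCompl X)
    rw [map_add, map_smul, ← hγ, P.oneForm_sharp, h0, map_zero, neg_zero]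
    change _ + _ • α u.field = 0
    rw [(Submodule.mem_dualAnnihilator α).1 hα _ u.field_mem, smul_zero, add_zero]
  · rintro ⟨X, hX⟩
    obtain ⟨γ, hγ, rfl⟩ := ν.exists_sharp_eq hP hX
    exact ⟨⟨γ, hγ⟩, rfl⟩

lemma coe_sharpEquiv (hP : P.IsRegularOfRank 2) (α : ν.fields.dualAnnihilator) :
    (u.sharpEquiv hP α : SmoothVectorField E M) = P.sharp α := rfl

lemma sharp_projection (α : OneForm E M) :
    P.sharp (ν.fields.dualAnnihilator.projection _ u.formComplement.isCompl α) = P.sharp α := by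
  conv_rhs => rw [u.formComplement.eq_projection_add α]
  rw [map_add, map_smul]
  change _ = _ + _ • P.sharp u.form
  rw [u.sharp_form, smul_zero, add_zero]

lemma bivector_projection (α γ : OneForm E M) :
    P.bivector (ν.fields.dualAnnihilator.projection _ u.formComplement.isCompl α)
      (ν.fields.dualAnnihilator.projection _ u.formComplement.isCompl γ) = P.bivector α γ := by
  rw [bivector, u.sharp_projection, P.oneForm_sharp, u.sharp_projection, ← P.oneForm_sharp]
  rfl

/-- At a given point some `Λ(α, γ)` is nonzero, and projecting both forms to the tangential part
does not change it. Then `Λ(α, γ) η` is a combination of the projected forms for every tangential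
`η`, so `pow_three_mul_alternatingMap` applies and its factor can be cancelled at the point. -/
lemma alternatingMap_three_eq_zero (u : ν.UnitField) (hP : P.IsRegularOfRank 2)
    (q : ν.fields.dualAnnihilator [⋀^Fin 3]→ₗ[SmoothFunction E M] SmoothFunction E M) : q = 0 := by
  ext v x
  obtain ⟨α, γ, h⟩ := P.exists_bivector_ne_zero hP x
  rw [← u.bivector_projection] at h
  have hα := Submodule.projection_apply_mem u.formComplement.isCompl α
  have hγ := Submodule.projection_apply_mem u.formComplement.isCompl γ
  generalize ν.fields.dualAnnihilator.projection _ u.formComplement.isCompl α = α' at *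
  generalize ν.fields.dualAnnihilator.projection _ u.formComplement.isCompl γ = γ' at *
  have key := pow_three_mul_alternatingMap (l := P.bivector α' γ')
    (t := fun η : ν.fields.dualAnnihilator => γ' (P.sharp η))
    (s := fun η : ν.fields.dualAnnihilator => α' (P.sharp η))
    (g₁ := ⟨α', hα⟩) (g₂ := ⟨γ', hγ⟩) (fun η => (u.sharpEquiv hP).injective <| Subtype.ext <| by
      rw [coe_sharpEquiv, coe_sharpEquiv]
      change P.sharp (P.bivector α' γ' • (η : OneForm E M)) =
        P.sharp (γ' (P.sharp η) • α' - α' (P.sharp η) • γ')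
      rw [P.sharp_bivector hP _ _ (P.sharp_mem_tangentialFields _), map_smul]) q v
  have hx := congrArg (fun g : SmoothFunction E M => g x) key
  change P.bivector α' γ' x ^ 3 * q v x = 0 at hx
  exact (mul_eq_zero.1 hx).resolve_left (pow_ne_zero 3 h)

/-- The map `#` is a homomorphism for the brackets of 1-forms and of vector fields. -/
lemma sharp_koszulBracket (u : ν.UnitField) (hP : P.IsRegularOfRank 2) {α γ : OneForm E M} (hα : α ∈ ν.fields.dualAnnihilator)
    (hγ : γ ∈ ν.fields.dualAnnihilator) :
    P.sharp (P.koszulBracket α γ) = lieBracket (P.sharp α) (P.sharp γ) := by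
  let e := u.sharpEquiv hP
  have he : ∀ X : P.tangentialFields, P.sharp (e.symm X) = X := fun X =>
    congrArg Subtype.val (e.apply_symm_apply X)
  -- This is the leafwise symplectic form `ω(X, Y) = (#⁻¹ X)(Y)`.
  let w : P.tangentialFields [⋀^Fin 2]→ₗ[SmoothFunction E M] SmoothFunction E M :=
    alternatingOfBilin ((LinearMap.lcomp _ _ P.tangentialFields.subtype) ∘ₗ
      ν.fields.dualAnnihilator.subtype ∘ₗ (e.symm : P.tangentialFields →ₗ[_] _)) fun X => by
        change (e.symm X : OneForm E M) (X : SmoothVectorField E M) = 0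
        conv_lhs => rw [← he X]
        exact P.skew _
  have hw : ∀ X Y : P.tangentialFields, w ![X, Y] = (e.symm X : OneForm E M) Y := fun _ _ => rfl
  have hskew : ∀ X Y : P.tangentialFields, w ![X, Y] = -w ![Y, X] := fun X Y => by
    rw [hw, hw, ← he X, ← he Y, P.oneForm_sharp]
  refine vectorField_eq_of_oneForm fun δ => ?_
  let X : P.tangentialFields := e ⟨α, hα⟩
  let Y : P.tangentialFields := e ⟨γ, hγ⟩
  -- Replacing `δ` by its tangential part changes neither `δ^#` nor the values of `δ` on tangential
  -- fields.
  let D := ν.fields.dualAnnihilator.projectionOnto _ u.formComplement.isCompl δ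
  let Z : P.tangentialFields := e D
  have hX : ∀ V : P.tangentialFields, w ![X, V] = α V := fun V => by
    rw [hw, e.symm_apply_apply]
  have hY : ∀ V : P.tangentialFields, w ![Y, V] = γ V := fun V => by
    rw [hw, e.symm_apply_apply]
  have hZ : ∀ V : P.tangentialFields, w ![Z, V] = δ V := fun V => by
    rw [hw, e.symm_apply_apply]
    conv_rhs => rw [u.formComplement.eq_projection_add δ]
    change _ = _ + _ * u.form V
    rw [u.mem_tangentialFields.1 V.2, mul_zero, add_zero]
    rfl
  have hZ' : (Z : SmoothVectorField E M) = P.sharp δ := u.sharp_projection δ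
  let B := (tangentAlgebroid E M).restrict u.fieldComplement.isCompl
  have hB : ∀ U V : P.tangentialFields,
      (B.bracket U V : SmoothVectorField E M) = lieBracket (U : SmoothVectorField E M) V := fun U V =>
    Submodule.projection_apply_of_mem_left _ (u.lieBracket_mem U.2 V.2)
  -- The leafwise symplectic form is closed because every leafwise 3-form on a foliation by surfaces
  -- vanishes.
  have hzero : B.differential 2 w = 0 := by
    have h := u.alternatingMap_three_eq_zero hP
      ((B.differential 2 w).compLinearMap (e : _ →ₗ[SmoothFunction E M] P.tangentialFields))
    ext1 v
    have h1 := congrArg (fun r : ν.fields.dualAnnihilator [⋀^Fin 3]→ₗ[SmoothFunction E M]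
      SmoothFunction E M => r fun i => e.symm (v i)) h
    simpa using h1
  have h := congrArg (fun r : P.tangentialFields [⋀^Fin 3]→ₗ[SmoothFunction E M]
      SmoothFunction E M => r ![X, Y, Z]) hzero
  change B.differentialFun w ![X, Y, Z] = 0 at h
  rw [AnchoredBracket.differentialFun_two, hskew (B.bracket X Y), hskew (B.bracket X Z), hX, hX, hX,
    hY, hY, hZ, hB, hB, hB] at h
  change lieDerivFunction (P.sharp α) (γ Z) - lieDerivFunction (P.sharp γ) (α Z) +
    lieDerivFunction (Z : SmoothVectorField E M) (α (P.sharp γ)) -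
    -δ (lieBracket (P.sharp α) (P.sharp γ)) + -γ (lieBracket (P.sharp α) Z) +
    α (lieBracket (P.sharp γ) Z) = 0 at h
  rw [hZ', P.oneForm_sharp α γ] at h
  have hneg : lieDerivFunction (P.sharp δ) (-γ (P.sharp α)) =
      -lieDerivFunction (P.sharp δ) (γ (P.sharp α)) := map_neg (toDerivation (P.sharp δ)) _
  rw [hneg] at h
  -- With `X = α^#`, `Y = γ^#`, `Z = δ^#`, the equation `dω(X, Y, Z) = 0` is the claim paired with
  -- `δ`, once the left side is written as `-{α, γ}(δ^#)`.
  rw [P.oneForm_sharp]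
  simp only [koszulBracket, bivector, LinearMap.sub_apply, lieDerivOneForm_apply,
    differentialFunction_apply]
  linear_combination -h

lemma sharpEquiv_bracket (hP : P.IsRegularOfRank 2) (α γ : ν.fields.dualAnnihilator) :
    u.sharpEquiv hP ((P.cotangentAlgebroid.restrict u.formComplement.isCompl).bracket α γ) =
      ((tangentAlgebroid E M).restrict u.fieldComplement.isCompl).bracket (u.sharpEquiv hP α)
        (u.sharpEquiv hP γ) := by
  refine Subtype.ext ?_
  refine (u.sharp_projection _).trans ((u.sharp_koszulBracket hP α.2 γ.2).trans ?_)
  exact (Submodule.projection_apply_of_mem_left u.fieldComplement.isCompl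
    (u.lieBracket_mem (u.sharpEquiv hP α).2 (u.sharpEquiv hP γ).2)).symm

/-- The cohomology with values in the projectable 1-forms is the cohomology of the tangential 1-forms
with the projected bracket. -/
def projectableCohomologyEquiv (hP : P.IsRegularOfRank 2) (q : ℕ) : ν.ProjectableCohomology q 1 ≃ₗ[P.casimirs]
    TotalCohomology (P.cotangentAlgebroid.restrict u.formComplement.isCompl) P.casimirs
      (fun _ hf α => P.anchor_casimir hf α) q :=
  (u.fieldComplement.leafCohomologyOneEquiv (tangentAlgebroid E M) P.casimirs
    (fun _ hf _ hX => P.tangential_casimir hf hX) (fun _ h => u.lieBracket_field_mem h) q).trans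
  (totalCohomologyEquiv _ _ P.casimirs _ _ (u.sharpEquiv hP) (fun _ => rfl)
    (u.sharpEquiv_bracket hP) q)

end TransversalDistribution.UnitField
end PoissonStructure

end PoissonGeom
end

/-! ### The theorem -/

open PoissonGeom
theorem proposition6 {M : Type*} [TopologicalSpace M] [T2Space M] [SecondCountableTopology M]
    [ChartedSpace (EuclideanSpace ℝ (Fin 3)) M] [IsManifold 𝓘(ℝ, EuclideanSpace ℝ (Fin 3)) ∞ M]
    (hM : IsOrientable (EuclideanSpace ℝ (Fin 3)) M)
    (P : PoissonStructure (EuclideanSpace ℝ (Fin 3)) M) (hP : P.IsRegularOfRank 2)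
    (β : DifferentialForm (EuclideanSpace ℝ (Fin 3)) M 1) (hβ : P.DefinesFoliation β)
    (hdβ : exteriorDerivative (EuclideanSpace ℝ (Fin 3)) M 1 β = 0)
    (ν : P.TransversalDistribution) :
    Nonempty (P.PCohomology 2 ≃ₗ[ℝ]
        (ν.TPCohomology 2 ⧸ ν.sigmaTransversal) × ν.ProjectableCohomology 1 1) ∧
      Nonempty (P.PCohomology 3 ≃ₗ[P.casimirs] ν.ProjectableCohomology 2 1) ∧
      ∀ q : ℕ, Nonempty (ν.TPCohomology q ≃ₗ[P.casimirs] ν.ProjectableCohomology q 1) := by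
  let b : OneForm (EuclideanSpace ℝ (Fin 3)) M :=
    (AlternatingMap.ofSubsingleton _ _ _ (0 : Fin 1)).symm β
  have hb : ∀ X, b X = β fun _ => X := fun _ => rfl
  -- The leaves have dimension 2 in a 3-manifold, so at every point some vector is transversal and
  -- `β` does not vanish on `ν`.
  have htop : ∀ x : M, P.leafTangent x ≠ ⊤ := by
    intro x h
    have h2 := hP x
    rw [h, finrank_top] at h2
    have h3 : Module.finrank ℝ (TangentSpace 𝓘(ℝ, EuclideanSpace ℝ (Fin 3)) x) = 3 :=
      finrank_euclideanSpace_fin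
    omega
  obtain ⟨Y, hY, hbY⟩ := ν.exists_oneForm_apply_eq_one (β := b) hβ htop
  let u : ν.UnitField :=
    { form := b
      form_apply_eq_zero := hβ
      closed := fun X Z => by
        rw [hb, hb, hb, ← anchor_apply, ← anchor_apply]
        exact ((tangentAlgebroid _ M).differentialFun_one β X Z).symm.trans
          (congrArg (fun θ : DifferentialForm _ M 2 => θ ![X, Z]) hdβ)
      field := Y
      field_mem := hY
      form_field := hbY }
  -- On the side of 1-forms the generator of the complement is `β` itself, which is central with
  -- zero anchor.
  have hanchor : P.cotangentAlgebroid.anchor u.formComplement.gen = 0 := by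
    change (tangentAlgebroid _ M).anchor (P.sharp u.form) = 0
    rw [u.sharp_form, map_zero]
  have hbracket : ∀ α ∈ ν.fields.dualAnnihilator,
      P.cotangentAlgebroid.bracket u.formComplement.gen α = 0 := fun α _ => u.koszulBracket_form α
  have hthree := u.alternatingMap_three_eq_zero hP
  refine ⟨?_, ⟨?_⟩, fun q => ⟨?_⟩⟩
  · obtain ⟨e⟩ := u.formComplement.exists_totalCohomologyTwoEquiv P.cotangentAlgebroid P.casimirs
      (fun _ hf α _ => P.anchor_casimir hf α) (fun _ hf α => P.anchor_casimir hf α)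
      hanchor hbracket hthree
    exact ⟨e.trans (LinearEquiv.prodCongr (LinearEquiv.refl ℝ _)
      ((u.projectableCohomologyEquiv hP 1).symm.restrictScalars ℝ))⟩
  · exact (u.formComplement.totalCohomologyThreeEquiv P.cotangentAlgebroid P.casimirs
      (fun _ hf α => P.anchor_casimir hf α) hanchor hbracket hthree).trans
      (u.projectableCohomologyEquiv hP 2).symm
  · exact (u.formComplement.leafCohomologyZeroEquiv P.cotangentAlgebroid P.casimirs
      (fun _ hf α _ => P.anchor_casimir hf α) q).trans (u.projectableCohomologyEquiv hP q).symm
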